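/- Let $N\ge 1$ and let $\Omega\subset\mathbb{R}^N$ be a bounded domain with smooth boundary and outward unit normal $\nu$, convex in two orthogonal directions (no condition if $N=1$) and strictly star-shaped with respect to some $x_0\in\Omega$, i.e. star-shaped with $$\rho_0:=\min_{\partial\Omega}\,(x-x_0)\cdot\nu>0,\qquad\text{and put } d:=\max_{\overline\Omega}|x-x_0| .$$ Let $a,b,c,k>0$, $q>p>m>1$, $2p<m+q$, and let $g$ satisfy $0\le g(\xi)\le k\,\xi^{p-m+1}$ for all $\xi\ge 0$. Let $u_0\in C^{2+\theta}(\Omega)\cap C^1(\overline\Omega)$, for some $0<\theta<1$, be positive in $\Omega$ with $\nabla u_0\cdot\nu=g(u_0)$ on $\partial\Omega$. For some $0<t^*\le\infty$ let $u\in C^{2,1}(\Omega\times(0,t^*))\cap C^{1,0}(\overline\Omega\times[0,t^*))$ be a positive classical solution of $$\begin{cases}u_t=\Delta u^m+a\int_\Omega u^p-bu^q-c\,|\nabla\sqrt u|^2&\text{in }\Omega\times(0,t^*),\\ \nabla u\cdot\nu=g(u)&\text{on }\partial\Omega\times[0,t^*),\\ u(\cdot,0)=u_0&\text{in }\Omega.\end{cases}$$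 Put $$\alpha=\frac{q+m-2p}{q-p},\qquad \sigma=\frac{kd(p+1)(m+1)}{4\rho_0},$$ and, for $\epsilon>0$, $$M_1=\frac{2kNm}{\rho_0}+2a|\Omega|+\frac{8m\sigma^2\alpha}{(m+1)^2}\,\epsilon^{\frac{\alpha-1}{\alpha}},\qquad M_2=2b-\frac{8m\sigma^2\epsilon(1-\alpha)}{(m+1)^2}.$$ Then: 1. for every $\epsilon>0$ with $M_2>0$, $$\int_\Omega u(x,t)^2\,dx\le\max\left\{\int_\Omega u_0^2,\ |\Omega|\left(\frac{M_1}{M_2}\right)^{\frac{2}{q-p}}\right\}\qquad\text{for all }t\in[0,t^*);$$ 2. if $t^*$ is the maximal existence time of $u$, in the sense that either $t^*=\infty$, or $t^*<\infty$ and $\|u(\cdot,t)\|_{L^\infty(\Omega)}$ is unbounded on $[0,t^*)$, then $t^*=\infty$. -/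

import Mathlib

open Set MeasureTheory
open scoped Topology NNReal ContDiff

/-- `φ` is a smooth defining function of `Ω`: `Ω = {φ < 0}` and the gradient of `φ` does not
vanish on the boundary. -/
structure IsDefiningFunction {N : ℕ} (φ : EuclideanSpace ℝ (Fin N) → ℝ)
    (Ω : Set (EuclideanSpace ℝ (Fin N))) : Prop where
  smooth : ContDiff ℝ ∞ φ
  eq_sublevel : Ω = {x | φ x < 0}
  gradient_ne_zero : ∀ x ∈ frontier Ω, gradient φ x ≠ 0

/-- Bounded smooth domains of `ℝ^N`: nonempty, connected, open, bounded, with `C^∞` boundary.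
(For a bounded open set, having locally around each boundary point a smooth defining function is
the same as having a global one.) -/
structure IsBoundedSmoothDomain {N : ℕ} (Ω : Set (EuclideanSpace ℝ (Fin N))) : Prop where
  isOpen : IsOpen Ω
  isConnected : IsConnected Ω
  isBounded : Bornology.IsBounded Ω
  smooth_boundary : ∃ φ, IsDefiningFunction φ Ω

/-- `n` is the outward unit normal vector to `∂Ω` at the boundary point `x`. (The vector does not
depend on the defining function.) -/
def IsOutwardUnitNormal {N : ℕ} (Ω : Set (EuclideanSpace ℝ (Fin N)))
    (x n : EuclideanSpace ℝ (Fin N)) : Prop :=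
  x ∈ frontier Ω ∧ ∃ φ, IsDefiningFunction φ Ω ∧ n = ‖gradient φ x‖⁻¹ • gradient φ x

/-- `Ω` is convex in the direction `e`: it meets every line parallel to `e` in a convex set. -/
def ConvexInDirection {N : ℕ} (Ω : Set (EuclideanSpace ℝ (Fin N)))
    (e : EuclideanSpace ℝ (Fin N)) : Prop :=
  ∀ x : EuclideanSpace ℝ (Fin N), Convex ℝ {s : ℝ | x + s • e ∈ Ω}

/-- The geometric assumption on the domain, with origin `x₀` and the two numbers
`ρ₀ = min_{∂Ω} (x - x₀) · ν > 0` and `d = max_{closure Ω} |x - x₀|`. The convexity in two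
orthogonal directions is meaningful only in dimension at least two. -/
structure AssumptionA {N : ℕ} (Ω : Set (EuclideanSpace ℝ (Fin N)))
    (x₀ : EuclideanSpace ℝ (Fin N)) (ρ₀ d : ℝ) : Prop where
  domain : IsBoundedSmoothDomain Ω
  center_mem : x₀ ∈ Ω
  starShaped : StarConvex ℝ x₀ Ω
  convex_directions : 2 ≤ N → ∃ e f : EuclideanSpace ℝ (Fin N),
    e ≠ 0 ∧ f ≠ 0 ∧ inner ℝ e f = 0 ∧ ConvexInDirection Ω e ∧ ConvexInDirection Ω f
  isLeast_rho : IsLeast {r : ℝ | ∃ x n, IsOutwardUnitNormal Ω x n ∧ r = inner ℝ (x - x₀) n} ρ₀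
  rho_pos : 0 < ρ₀
  isGreatest_d : IsGreatest ((fun x => ‖x - x₀‖) '' closure Ω) d

/-- `v ∈ C^1(closure Ω)`, and `G` is the gradient of `v`, extended continuously up to the
boundary. -/
structure IsC1UpToBoundary {N : ℕ} (Ω : Set (EuclideanSpace ℝ (Fin N)))
    (v : EuclideanSpace ℝ (Fin N) → ℝ)
    (G : EuclideanSpace ℝ (Fin N) → EuclideanSpace ℝ (Fin N)) : Prop where
  continuousOn : ContinuousOn v (closure Ω)
  continuousOn_grad : ContinuousOn G (closure Ω)
  hasGradientAt : ∀ x ∈ Ω, HasGradientAt v (G x) x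

/-- `v ∈ C^{2+θ}(Ω)`: twice continuously differentiable in `Ω`, with second derivatives Hölder
continuous of exponent `θ` on compact subsets of `Ω`. -/
structure IsC2Holder {N : ℕ} (Ω : Set (EuclideanSpace ℝ (Fin N))) (θ : ℝ≥0)
    (v : EuclideanSpace ℝ (Fin N) → ℝ) : Prop where
  contDiffOn : ContDiffOn ℝ 2 v Ω
  holder : ∀ K ⊆ Ω, IsCompact K → ∃ C : ℝ≥0, HolderOnWith C θ (iteratedFDeriv ℝ 2 v) K

/-- The time interval `[0, T)`, `0 < T ≤ ∞`. -/
def timeIco (T : EReal) : Set ℝ := {t | 0 ≤ t ∧ (t : EReal) < T}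

/-- The time interval `(0, T)`, `0 < T ≤ ∞`. -/
def timeIoo (T : EReal) : Set ℝ := {t | 0 < t ∧ (t : EReal) < T}

/-- `u ∈ C^{1,0}(closure Ω × [0,T))`, and `G` is the spatial gradient of `u`, extended continuously
up to the lateral boundary. -/
structure IsC10 {N : ℕ} (Ω : Set (EuclideanSpace ℝ (Fin N))) (T : EReal)
    (u : EuclideanSpace ℝ (Fin N) → ℝ → ℝ)
    (G : EuclideanSpace ℝ (Fin N) → ℝ → EuclideanSpace ℝ (Fin N)) : Prop where
  continuousOn : ContinuousOn (fun z : EuclideanSpace ℝ (Fin N) × ℝ => u z.1 z.2)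
    (closure Ω ×ˢ timeIco T)
  continuousOn_grad : ContinuousOn (fun z : EuclideanSpace ℝ (Fin N) × ℝ => G z.1 z.2)
    (closure Ω ×ˢ timeIco T)
  hasGradientAt : ∀ x ∈ Ω, ∀ t ∈ timeIco T, HasGradientAt (fun y => u y t) (G x t) x

/-- `u ∈ C^{2,1}(Ω × (0,T))`: the derivatives of `u` up to order two in space and one in time
exist and are jointly continuous. -/
structure IsC21 {N : ℕ} (Ω : Set (EuclideanSpace ℝ (Fin N))) (T : EReal)
    (u : EuclideanSpace ℝ (Fin N) → ℝ → ℝ) : Prop where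
  contDiffOn_space : ∀ t ∈ timeIoo T, ContDiffOn ℝ 2 (fun y => u y t) Ω
  differentiableAt_time : ∀ x ∈ Ω, ∀ t ∈ timeIoo T, DifferentiableAt ℝ (u x) t
  continuousOn_space : ∀ i ≤ 2, ContinuousOn
    (fun z : EuclideanSpace ℝ (Fin N) × ℝ => iteratedFDeriv ℝ i (fun y => u y z.2) z.1)
    (Ω ×ˢ timeIoo T)
  continuousOn_time : ContinuousOn
    (fun z : EuclideanSpace ℝ (Fin N) × ℝ => deriv (u z.1) z.2) (Ω ×ˢ timeIoo T)

/-- `u` is a (positive) classical solution on `Ω × [0,T)` of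
`u_t = Δ u^m + a ∫_Ω u^p - b u^q - c |∇√u|²` with `∂u/∂ν = g(u)` on the boundary and initial
datum `u₀`. -/
structure IsClassicalSolution {N : ℕ} (Ω : Set (EuclideanSpace ℝ (Fin N)))
    (a b c m p q : ℝ) (g : ℝ → ℝ) (u₀ : EuclideanSpace ℝ (Fin N) → ℝ) (T : EReal)
    (u : EuclideanSpace ℝ (Fin N) → ℝ → ℝ) : Prop where
  time_pos : 0 < T
  pos : ∀ x ∈ Ω, ∀ t ∈ timeIco T, 0 < u x t
  regular_interior : IsC21 Ω T u
  equation : ∀ x ∈ Ω, ∀ t ∈ timeIoo T,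
    deriv (u x) t = Laplacian.laplacian (fun y => u y t ^ m) x + a * (∫ y in Ω, u y t ^ p)
      - b * u x t ^ q - c * ‖gradient (fun y => √(u y t)) x‖ ^ 2
  regular_boundary : ∃ G, IsC10 Ω T u G ∧
    ∀ t ∈ timeIco T, ∀ x n, IsOutwardUnitNormal Ω x n → inner ℝ (G x t) n = g (u x t)
  initial : ∀ x ∈ Ω, u x 0 = u₀ x

/-- `T` is the maximal existence time of `u`, in the sense of the blow-up alternative: either
`T = ∞`, or `T` is finite and the `L^∞(Ω)` norm of `u(·,t)` does not stay bounded as `t` runs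
through `[0,T)`. -/
def IsMaximalTime {N : ℕ} (Ω : Set (EuclideanSpace ℝ (Fin N))) (T : EReal)
    (u : EuclideanSpace ℝ (Fin N) → ℝ → ℝ) : Prop :=
  T = ⊤ ∨ (T < ⊤ ∧ ∀ C : ℝ, ∃ t ∈ timeIco T, ∃ x ∈ Ω, C < u x t)

/-- The exponent `α = (q + m - 2p) / (q - p)`. -/
noncomputable def alphaExp (m p q : ℝ) : ℝ := (q + m - 2 * p) / (q - p)

/-- The constant `σ = k d (p+1) (m+1) / (4 ρ₀)`. -/
noncomputable def sigmaConst (k m p ρ₀ d : ℝ) : ℝ := k * d * (p + 1) * (m + 1) / (4 * ρ₀)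

/-- The constant `M₁`; `vol` stands for the volume of the domain. -/
noncomputable def M₁ (N : ℕ) (vol a k m p q ρ₀ d ε : ℝ) : ℝ :=
  2 * k * N * m / ρ₀ + 2 * a * vol
    + 8 * m * sigmaConst k m p ρ₀ d ^ 2 * alphaExp m p q / (m + 1) ^ 2
      * ε ^ ((alphaExp m p q - 1) / alphaExp m p q)

/-- The constant `M₂`. -/
noncomputable def M₂ (b k m p q ρ₀ d ε : ℝ) : ℝ :=
  2 * b - 8 * m * sigmaConst k m p ρ₀ d ^ 2 * ε * (1 - alphaExp m p q) / (m + 1) ^ 2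

/-!
Both parts use only what the definition of a classical solution provides: no second derivatives up
to the boundary and no surface integrals.

**The bound of the `L ^ 2` norm.** Formally, multiply the equation by `2 u` and integrate. The
boundary flux of `u ^ m` gives `2 m k ∫_∂Ω u ^ (p + 1)`, and strict star-shapedness bounds this
surface integral by `ρ₀⁻¹ ∫ div (u ^ (p + 1) (x - x₀))`. The resulting term in `u ^ p |∇ u|` is
absorbed by the dissipation `u ^ (m - 1) |∇ u| ^ 2`, the nonlocal term is treated by Chebyshev's
inequality (`integral_mul_integral_rpow_le`), and Young's inequality (`rpow_le_young`) leads to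
`d/dt ∫ u ^ 2 ≤ M₁ ∫ u ^ (p + 1) - M₂ ∫ u ^ (q + 1)`. A tangent-line inequality
(`exists_linear_bound`) bounds the right-hand side by `C (L - ∫ u ^ 2)`, where `L` is the second
entry of the maximum in the statement, so `∫ u ^ 2` cannot rise above the maximum of its initial
value and `L`.

The surface integrals are avoided as follows. With a defining function `φ`, take the cut-off
functions `η` (`cutoff`), equal to `1` where `φ ≤ -2δ` and to `0` where `φ ≥ -δ`; then
`∇ η = -ψ ∇ φ` with `ψ ≥ 0` supported in a boundary layer. Integrating the divergence of the compactly
supported field `η (2 u ∇ u ^ m - (2 m / ρ) (k u ^ (p + 1) + κ) (x - x₀))`, with `ρ < ρ₀` and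
`κ > 0`, the terms with `ψ` have a sign: the boundary inequalities are strict after weakening `ρ₀`
to `ρ` and adding `κ`, hence persist in the layer, uniformly on compact time intervals
(`integral_mul_laplacian_le`). The energy `∫ η u ^ 2` is differentiable in time
(`IsClassicalSolution.hasDerivAt_integral`), and letting `δ → 0` on a time interval where `∫ u ^ 2`
exceeds the claimed bound gives a contradiction; finally `ρ → ρ₀`.

**Global existence.** The solution is bounded uniformly in time (`IsClassicalSolution.exists_bound`),
by comparison of `u ^ m` with the barrier `A (1 + exp (K φ))`. Its normal derivative on the boundary
is `A K |∇ φ|`, which beats the flux `m k (2 A) ^ (p / m)` when `K` is a large multiple of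
`A ^ (p / m - 1)`. Its Laplacian is then of order `A K ^ 2 ~ A ^ (2 p / m - 1)`, which for large `A`
is dominated by the absorption `b A ^ (q / m)`, precisely because `2 p < m + q`. At the first time of
contact, either a boundary or an interior contact point contradicts one of these inequalities.
-/

/-! ### Laplacian at a maximum and integration by parts -/

theorem laplacian_eq_sum_fderiv {N : ℕ} {f : EuclideanSpace ℝ (Fin N) → ℝ}
    {x : EuclideanSpace ℝ (Fin N)} (hf : ContDiffAt ℝ 2 f x) :
    Laplacian.laplacian f x = ∑ i, fderiv ℝ (fun y => fderiv ℝ f y (EuclideanSpace.single i 1)) x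
      (EuclideanSpace.single i 1) := by
  rw [InnerProductSpace.laplacian_eq_iteratedFDeriv_orthonormalBasis f
    (EuclideanSpace.basisFun (Fin N) ℝ)]
  refine Finset.sum_congr rfl fun i _ => ?_
  have hd : DifferentiableAt ℝ (fderiv ℝ f) x :=
    (hf.fderiv_right (m := 1) (by norm_num)).differentiableAt (by norm_num)
  rw [iteratedFDeriv_two_apply, fderiv_clm_apply hd (differentiableAt_const _)]
  simp

theorem deriv_deriv_nonpos_of_isLocalMax {f : ℝ → ℝ} {x : ℝ} (h : IsLocalMax f x)
    (hc : ContinuousAt f x) : deriv (deriv f) x ≤ 0 := by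
  by_contra! hpos
  -- otherwise `x` is also a local minimum, so `f` is locally constant
  have hmin := isLocalMin_of_deriv_deriv_pos hpos h.deriv_eq_zero hc
  have hconst : f =ᶠ[𝓝 x] fun _ => f x := by
    filter_upwards [h, hmin] with y h1 h2 using le_antisymm h1 h2
  have := hconst.deriv.deriv_eq
  simp at this
  exact hpos.ne' this

theorem laplacian_nonpos_of_isLocalMax {N : ℕ} {f : EuclideanSpace ℝ (Fin N) → ℝ}
    {x : EuclideanSpace ℝ (Fin N)} (hf : ContDiffAt ℝ 2 f x) (hx : IsLocalMax f x) :
    Laplacian.laplacian f x ≤ 0 := by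
  rw [laplacian_eq_sum_fderiv hf]
  refine Finset.sum_nonpos fun i _ => ?_
  set e : EuclideanSpace ℝ (Fin N) := EuclideanSpace.single i 1
  set l : ℝ → EuclideanSpace ℝ (Fin N) := fun s => x + s • e with hl
  have hld : ∀ s, HasDerivAt l e s := fun s => by
    have h := ((hasDerivAt_id s).smul_const e).const_add x
    rw [one_smul] at h
    exact h
  have hl0 : l 0 = x := by simp [hl]
  have hlc : Filter.Tendsto l (𝓝 0) (𝓝 x) := by
    have := (hld 0).continuousAt.tendsto; rwa [hl0] at this
  have hev : ∀ᶠ s in 𝓝 (0 : ℝ), ContDiffAt ℝ 2 f (l s) :=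
    hlc.eventually (hf.eventually (by norm_num))
  have h1 : deriv (fun s => f (l s)) =ᶠ[𝓝 0] fun s => fderiv ℝ f (l s) e := by
    filter_upwards [hev] with s hs
    exact ((hs.differentiableAt (by norm_num)).hasFDerivAt.comp_hasDerivAt s (hld s)).deriv
  have hd : DifferentiableAt ℝ (fun y => fderiv ℝ f y e) x :=
    ((hf.fderiv_right (m := 1) (by norm_num)).differentiableAt (by norm_num)).clm_apply
      (differentiableAt_const _)
  have h2 : deriv (fun s => fderiv ℝ f (l s) e) 0 = fderiv ℝ (fun y => fderiv ℝ f y e) x e := by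
    rw [← hl0] at hd
    rw [← hl0]
    exact (hd.hasFDerivAt.comp_hasDerivAt (0 : ℝ) (hld 0)).deriv
  rw [← h2, ← h1.deriv_eq]
  refine deriv_deriv_nonpos_of_isLocalMax ?_ ?_
  · have := hlc.eventually hx
    filter_upwards [this] with s hs
    rwa [hl0]
  · rw [← hl0] at hf
    exact ContinuousAt.comp (f := l) (g := f) hf.continuousAt (hld 0).continuousAt

theorem gradient_apply {N : ℕ} (f : EuclideanSpace ℝ (Fin N) → ℝ)
    (x : EuclideanSpace ℝ (Fin N)) (i : Fin N) :
    gradient f x i = fderiv ℝ f x (EuclideanSpace.single i 1) := by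
  rw [← inner_gradient_left, EuclideanSpace.inner_single_right]
  simp

theorem laplacian_exp_mul {N : ℕ} {φ : EuclideanSpace ℝ (Fin N) → ℝ} (hφ : ContDiff ℝ 2 φ)
    (K : ℝ) (x : EuclideanSpace ℝ (Fin N)) :
    Laplacian.laplacian (fun y => Real.exp (K * φ y)) x =
      Real.exp (K * φ x) * (K ^ 2 * ‖gradient φ x‖ ^ 2 + K * Laplacian.laplacian φ x) := by
  have hd : ∀ y, DifferentiableAt ℝ φ y := fun y => (hφ.differentiable (by norm_num)) y
  have hexp : ContDiff ℝ 2 (fun y => Real.exp (K * φ y)) := by fun_prop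
  rw [laplacian_eq_sum_fderiv hexp.contDiffAt, laplacian_eq_sum_fderiv hφ.contDiffAt,
    EuclideanSpace.norm_sq_eq, Finset.mul_sum, Finset.mul_sum, ← Finset.sum_add_distrib,
    Finset.mul_sum]
  refine Finset.sum_congr rfl fun i _ => ?_
  set e : EuclideanSpace ℝ (Fin N) := EuclideanSpace.single i 1
  have h1 : ∀ y, HasFDerivAt (fun y => Real.exp (K * φ y))
      (Real.exp (K * φ y) • (K • fderiv ℝ φ y)) y := fun y =>
    ((hd y).hasFDerivAt.const_mul K).exp
  have h2 : (fun y => fderiv ℝ (fun y => Real.exp (K * φ y)) y e) =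
      fun y => Real.exp (K * φ y) * (K * fderiv ℝ φ y e) := by
    funext y; rw [(h1 y).fderiv]; simp
  have h3 : HasFDerivAt (fun y => fderiv ℝ φ y e) (fderiv ℝ (fun y => fderiv ℝ φ y e) x) x :=
    (((hφ.contDiffAt.fderiv_right (m := 1) (by norm_num)).differentiableAt (by norm_num)).clm_apply
      (differentiableAt_const _)).hasFDerivAt
  have h4 : HasFDerivAt (fun y => Real.exp (K * φ y) * (K * fderiv ℝ φ y e)) _ x :=
    (h1 x).mul (h3.const_mul K)
  rw [h2, h4.fderiv, gradient_apply]
  simp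
  ring

theorem integral_fderiv_eq_zero_of_hasCompactSupport {N : ℕ} {f : EuclideanSpace ℝ (Fin N) → ℝ}
    (hf : ContDiff ℝ 1 f) (hc : HasCompactSupport f) (v : EuclideanSpace ℝ (Fin N)) :
    ∫ x, fderiv ℝ f x v = 0 := by
  have h1 : Continuous fun x => fderiv ℝ f x v :=
    (hf.continuous_fderiv (by norm_num)).clm_apply continuous_const
  have h2 : Integrable fun x => fderiv ℝ f x v :=
    h1.integrable_of_hasCompactSupport (hc.fderiv_apply (𝕜 := ℝ) v)
  have := integral_mul_fderiv_eq_neg_fderiv_mul_of_integrable (μ := volume) (𝕜 := ℝ)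
    (f := fun _ : EuclideanSpace ℝ (Fin N) => (1 : ℝ)) (g := f) (v := v)
    (by simp) (by simpa using h2)
    (by simpa using hf.continuous.integrable_of_hasCompactSupport hc)
    (by intros; fun_prop) (fun x _ => (hf.differentiable (by norm_num)) x)
  simpa using this

/-! ### Defining functions and one-sided derivatives -/

theorem mem_timeIco_of_le {T : EReal} {s t : ℝ} (ht : t ∈ timeIco T) (hs : 0 ≤ s) (hst : s ≤ t) :
    s ∈ timeIco T :=
  ⟨hs, lt_of_le_of_lt (EReal.coe_le_coe_iff.2 hst) ht.2⟩

theorem mem_timeIco_of_mem_timeIoo {T : EReal} {t : ℝ} (ht : t ∈ timeIoo T) : t ∈ timeIco T :=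
  ⟨ht.1.le, ht.2⟩

theorem isOpen_timeIoo (T : EReal) : IsOpen (timeIoo T) :=
  isOpen_Ioi.inter (isOpen_Iio.preimage continuous_coe_real_ereal)

theorem continuous_gradient {N : ℕ} {φ : EuclideanSpace ℝ (Fin N) → ℝ} (hφ : ContDiff ℝ 1 φ) :
    Continuous (gradient φ) :=
  (InnerProductSpace.toDual ℝ _).symm.continuous.comp (hφ.continuous_fderiv (by norm_num))

theorem continuous_laplacian {N : ℕ} {φ : EuclideanSpace ℝ (Fin N) → ℝ} (hφ : ContDiff ℝ 2 φ) :
    Continuous (Laplacian.laplacian φ) := by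
  rw [InnerProductSpace.laplacian_eq_iteratedFDeriv_orthonormalBasis φ
    (EuclideanSpace.basisFun (Fin N) ℝ)]
  have h : Continuous (iteratedFDeriv ℝ 2 φ) := hφ.continuous_iteratedFDeriv (by norm_num)
  fun_prop

section DefiningFunction

variable {N : ℕ} {Ω : Set (EuclideanSpace ℝ (Fin N))} {φ : EuclideanSpace ℝ (Fin N) → ℝ}
  {x : EuclideanSpace ℝ (Fin N)}

theorem IsDefiningFunction.mem_iff (hφ : IsDefiningFunction φ Ω) : x ∈ Ω ↔ φ x < 0 := by
  rw [hφ.eq_sublevel]; rfl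

theorem IsDefiningFunction.nonpos_of_mem_closure (hφ : IsDefiningFunction φ Ω)
    (hx : x ∈ closure Ω) : φ x ≤ 0 :=
  closure_minimal (fun _ hy => (hφ.mem_iff.1 hy).le)
    (isClosed_le hφ.smooth.continuous continuous_const) hx

theorem IsDefiningFunction.eq_zero_of_mem_frontier (hφ : IsDefiningFunction φ Ω)
    (hΩ : IsOpen Ω) (hx : x ∈ frontier Ω) : φ x = 0 := by
  refine le_antisymm (hφ.nonpos_of_mem_closure (frontier_subset_closure hx)) ?_
  by_contra! h
  rw [hΩ.frontier_eq] at hx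
  exact hx.2 (hφ.mem_iff.2 h)

theorem IsDefiningFunction.isOutwardUnitNormal (hφ : IsDefiningFunction φ Ω)
    (hx : x ∈ frontier Ω) : IsOutwardUnitNormal Ω x (‖gradient φ x‖⁻¹ • gradient φ x) :=
  ⟨hx, φ, hφ, rfl⟩

theorem IsDefiningFunction.exists_le_norm_gradient (hφ : IsDefiningFunction φ Ω)
    (hb : Bornology.IsBounded Ω) : ∃ c₀ > 0, ∀ x ∈ frontier Ω, c₀ ≤ ‖gradient φ x‖ := by
  have hc : IsCompact (frontier Ω) :=
    hb.isCompact_closure.of_isClosed_subset isClosed_frontier frontier_subset_closure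
  rcases (frontier Ω).eq_empty_or_nonempty with h | h
  · exact ⟨1, one_pos, by simp [h]⟩
  · obtain ⟨y, hy, hmin⟩ := hc.exists_isMinOn h
      (continuous_gradient (hφ.smooth.of_le (by norm_cast))).norm.continuousOn
    exact ⟨_, norm_pos_iff.2 (hφ.gradient_ne_zero y hy), fun x hx => hmin hx⟩

end DefiningFunction

theorem deriv_nonneg_of_forall_lt_le {f : ℝ → ℝ} {t : ℝ} (hf : DifferentiableAt ℝ f t)
    (h : ∀ᶠ s in 𝓝[<] t, f s ≤ f t) : 0 ≤ deriv f t := by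
  have h1 := (hasDerivWithinAt_iff_tendsto_slope' (s := Iio t) (by simp)).1
    hf.hasDerivAt.hasDerivWithinAt
  refine ge_of_tendsto h1 ?_
  filter_upwards [h, self_mem_nhdsWithin] with s hs hst
  rw [slope_def_field]
  exact div_nonneg_of_nonpos (by linarith) (by linarith [mem_Iio.1 hst])

/-- A function which is maximal at the left end of an interval has nonpositive one-sided
derivative there; the derivative is given as a limit of derivatives from the right. -/
theorem nonpos_of_tendsto_deriv_of_le {f f' : ℝ → ℝ} {l : ℝ}
    (hc : ContinuousWithinAt f (Ioi 0) 0) (hd : ∀ᶠ s in 𝓝[>] (0 : ℝ), HasDerivAt f (f' s) s)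
    (hl : Filter.Tendsto f' (𝓝[>] 0) (𝓝 l)) (h : ∀ᶠ s in 𝓝[>] (0 : ℝ), f s ≤ f 0) : l ≤ 0 := by
  obtain ⟨ε, hε, hs⟩ := mem_nhdsGT_iff_exists_Ioo_subset.1 hd
  have h1 : HasDerivWithinAt f l (Ici 0) 0 := by
    refine hasDerivWithinAt_Ici_of_tendsto_deriv (s := Ioo 0 ε)
      (fun s hs' => (hs hs').differentiableAt.differentiableWithinAt)
      (hc.mono Ioo_subset_Ioi_self) (Ioo_mem_nhdsGT hε) (hl.congr' ?_)
    filter_upwards [hd] with s hs' using hs'.deriv.symm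
  have h2 := (hasDerivWithinAt_iff_tendsto_slope' (s := Ioi 0) (by simp)).1
    (h1.mono Ioi_subset_Ici_self)
  refine le_of_tendsto h2 ?_
  filter_upwards [h, self_mem_nhdsWithin] with s hs hst
  rw [slope_def_field]
  exact div_nonpos_of_nonpos_of_nonneg (by linarith) (by linarith [mem_Ioi.1 hst])

theorem IsClassicalSolution.nonneg {N : ℕ} {Ω : Set (EuclideanSpace ℝ (Fin N))}
    {a b c m p q : ℝ} {g : ℝ → ℝ} {u₀ : EuclideanSpace ℝ (Fin N) → ℝ} {T : EReal}
    {u : EuclideanSpace ℝ (Fin N) → ℝ → ℝ} (hu : IsClassicalSolution Ω a b c m p q g u₀ T u)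
    {x : EuclideanSpace ℝ (Fin N)} {t : ℝ} (hx : x ∈ closure Ω) (ht : t ∈ timeIco T) :
    0 ≤ u x t := by
  obtain ⟨G, hG, -⟩ := hu.regular_boundary
  have h1 : ContinuousOn (fun y => u y t) (closure Ω) :=
    hG.continuousOn.comp (f := fun y => (y, t)) (by fun_prop) fun y hy => ⟨hy, ht⟩
  have h2 : MapsTo (fun y => u y t) Ω (Ici 0) := fun y hy => (hu.pos y hy t ht).le
  simpa using h2.closure_of_continuousOn h1 hx

/-- The height `A` and the slope `K` of the barrier `A (1 + exp (K φ))`: for `K` of the order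
`A ^ (p / m - 1)`, the exponent condition `2 * p < m + q` makes the absorption term win. -/
theorem exists_barrier_parameters {b m p q : ℝ} (hb : 0 < b) (hm : 1 < m) (hmp : m < p)
    (hpq : p < q) (hmpq : 2 * p < m + q) {κ₁ κ₂ C c₀ : ℝ} (hκ₁ : 0 ≤ κ₁) (hc₀ : 0 < c₀)
    (A₀ : ℝ) :
    ∃ A K : ℝ, A₀ < A ∧ 0 < A ∧ 1 ≤ K ∧ κ₁ * (2 * A) ^ (p / m) < A * K * c₀ ∧
      A * (C * K ^ 2) + κ₂ * (2 * A) ^ (p / m) < b * A ^ (q / m) := by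
  have hm0 : 0 < m := by linarith
  set C₁ := κ₁ * 2 ^ (p / m) / c₀ + 1 with hC₁
  have hC₁' : 1 ≤ C₁ := by
    have : 0 ≤ κ₁ * 2 ^ (p / m) / c₀ := by positivity
    linarith
  have e1 : 0 < (q + m - 2 * p) / m := div_pos (by linarith) hm0
  have e2 : 0 < (q - p) / m := div_pos (sub_pos.2 hpq) hm0
  have l1 := (tendsto_rpow_neg_atTop e1).const_mul (C * C₁ ^ 2)
  have l2 := (tendsto_rpow_neg_atTop e2).const_mul (κ₂ * 2 ^ (p / m))
  have l3 := l1.add l2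
  simp only [mul_zero, add_zero] at l3
  obtain ⟨A, hA, hA0, hA1⟩ := ((l3.eventually_lt_const hb).and
    ((Filter.eventually_gt_atTop A₀).and (Filter.eventually_ge_atTop 1))).exists
  have hApos : 0 < A := by linarith
  have hA2 : (2 * A) ^ (p / m) = 2 ^ (p / m) * A ^ (p / m) :=
    Real.mul_rpow (by norm_num) hApos.le
  have hAA : A * A ^ (p / m - 1) = A ^ (p / m) := by
    rw [Real.rpow_sub hApos, Real.rpow_one]; field_simp
  refine ⟨A, C₁ * A ^ (p / m - 1), hA0, hApos, ?_, ?_, ?_⟩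
  · have : 1 ≤ A ^ (p / m - 1) :=
      Real.one_le_rpow hA1 (by rw [sub_nonneg, one_le_div hm0]; exact hmp.le)
    nlinarith
  · have h1 : A * (C₁ * A ^ (p / m - 1)) * c₀ = (κ₁ * 2 ^ (p / m) + c₀) * A ^ (p / m) := by
      rw [← hAA, hC₁]; field_simp
    rw [h1, hA2]
    have : 0 < c₀ * A ^ (p / m) := by positivity
    nlinarith
  · have h1 : A ^ (-((q + m - 2 * p) / m)) * A ^ (q / m) = A * (A ^ (p / m - 1)) ^ 2 := by
      rw [← Real.rpow_natCast, ← Real.rpow_mul hApos.le, ← Real.rpow_add hApos]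
      nth_rewrite 2 [← Real.rpow_one A]
      rw [← Real.rpow_add hApos]
      congr 1; field_simp; push_cast; ring
    have h2 : A ^ (-((q - p) / m)) * A ^ (q / m) = A ^ (p / m) := by
      rw [← Real.rpow_add hApos]
      congr 1; field_simp; ring
    have h3 : 0 < A ^ (q / m) := by positivity
    have h4 := mul_lt_mul_of_pos_right hA h3
    rw [add_mul, mul_assoc (C * C₁ ^ 2), h1, mul_assoc (κ₂ * 2 ^ (p / m)), h2] at h4
    rw [hA2]
    calc _ = C * C₁ ^ 2 * (A * (A ^ (p / m - 1)) ^ 2) + κ₂ * 2 ^ (p / m) * A ^ (p / m) := by ring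
      _ < _ := h4

/-! ### The uniform bound by comparison with a barrier -/

section Comparison

variable {N : ℕ} {Ω : Set (EuclideanSpace ℝ (Fin N))} {a b c k m p q : ℝ} {g : ℝ → ℝ}
  {u₀ : EuclideanSpace ℝ (Fin N) → ℝ} {T : EReal} {u : EuclideanSpace ℝ (Fin N) → ℝ → ℝ}
  {φ : EuclideanSpace ℝ (Fin N) → ℝ} {A K : ℝ}

/-- At an interior point where `u ^ m` touches the barrier from below, the equation gives
`0 ≤ Δ (barrier) + a ∫ u ^ p - b u ^ q`. -/
theorem IsClassicalSolution.barrier_interior (hu : IsClassicalSolution Ω a b c m p q g u₀ T u)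
    (hΩ : IsOpen Ω) (hc : 0 ≤ c) (hφ : ContDiff ℝ 2 φ)
    {x : EuclideanSpace ℝ (Fin N)} {t : ℝ} (hx : x ∈ Ω) (ht : t ∈ timeIoo T)
    (heq : u x t ^ m = A * (1 + Real.exp (K * φ x)))
    (hle : ∀ y ∈ Ω, u y t ^ m ≤ A * (1 + Real.exp (K * φ y)))
    (hpast : ∀ s, 0 ≤ s → s < t → u x s ≤ u x t) :
    0 ≤ A * (Real.exp (K * φ x) * (K ^ 2 * ‖gradient φ x‖ ^ 2 + K * Laplacian.laplacian φ x))
      + a * (∫ y in Ω, u y t ^ p) - b * u x t ^ q := by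
  have hdt : 0 ≤ deriv (u x) t := by
    refine deriv_nonneg_of_forall_lt_le (hu.regular_interior.differentiableAt_time x hx t ht) ?_
    filter_upwards [Ioo_mem_nhdsLT ht.1] with s hs using hpast s hs.1.le hs.2
  have huC : ContDiffAt ℝ 2 (fun y => u y t) x :=
    (hu.regular_interior.contDiffOn_space t ht).contDiffAt (hΩ.mem_nhds hx)
  have hum : ContDiffAt ℝ 2 (fun y => u y t ^ m) x :=
    huC.rpow_const_of_ne (hu.pos x hx t (mem_timeIco_of_mem_timeIoo ht)).ne'
  have hexp : ContDiff ℝ 2 (fun y => Real.exp (K * φ y)) := by fun_prop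
  have hW : ContDiff ℝ 2 (A • fun y => Real.exp (K * φ y)) := hexp.const_smul A
  have hmax : IsLocalMax ((fun y => u y t ^ m) - (A • fun y => Real.exp (K * φ y))) x := by
    filter_upwards [hΩ.mem_nhds hx] with y hy
    have := hle y hy
    simp only [Pi.sub_apply, Pi.smul_apply, smul_eq_mul]
    linarith
  have hlap : Laplacian.laplacian ((fun y => u y t ^ m) - A • fun y => Real.exp (K * φ y)) x ≤ 0 :=
    laplacian_nonpos_of_isLocalMax (hum.sub hW.contDiffAt) hmax
  rw [ContDiffAt.laplacian_sub hum hW.contDiffAt,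
    InnerProductSpace.laplacian_smul A hexp.contDiffAt, laplacian_exp_mul hφ, smul_eq_mul] at hlap
  have heqn := hu.equation x hx t ht
  have : 0 ≤ c * ‖gradient (fun y => √(u y t)) x‖ ^ 2 := by positivity
  linarith

/-- At a boundary point where `u ^ m` touches the barrier from below, the outer normal derivative
of `u ^ m` is at least that of the barrier. -/
theorem barrier_boundary (hΩ : IsOpen Ω) (hm : 1 < m) (hφ : IsDefiningFunction φ Ω)
    {G : EuclideanSpace ℝ (Fin N) → ℝ → EuclideanSpace ℝ (Fin N)} (hG : IsC10 Ω T u G)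
    {x : EuclideanSpace ℝ (Fin N)} {t : ℝ} (hx : x ∈ frontier Ω) (ht : t ∈ timeIco T)
    (hpos : ∀ y ∈ Ω, 0 < u y t)
    (heq : u x t ^ m = A * (1 + Real.exp (K * φ x)))
    (hle : ∀ y ∈ Ω, u y t ^ m ≤ A * (1 + Real.exp (K * φ y))) :
    A * K * ‖gradient φ x‖ ^ 2 ≤ m * u x t ^ (m - 1) * inner ℝ (G x t) (gradient φ x) := by
  have hφ1 : ContDiff ℝ 1 φ := hφ.smooth.of_le (by norm_cast)
  have hφd : ∀ y, HasGradientAt φ (gradient φ y) y := fun y =>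
    (hφ1.differentiable (by norm_num) y).hasGradientAt
  have hφ0 : φ x = 0 := hφ.eq_zero_of_mem_frontier hΩ hx
  have hxc : x ∈ closure Ω := frontier_subset_closure hx
  set e := gradient φ x with he
  set l : ℝ → EuclideanSpace ℝ (Fin N) := fun s => x - s • e with hl
  have hl0 : l 0 = x := by simp [hl]
  have hld : ∀ s, HasDerivAt l (-e) s := fun s => by
    have h := ((hasDerivAt_id s).smul_const e).const_sub x
    rw [one_smul] at h
    exact h
  have hlc : Continuous l := by fun_prop
  -- the inner normal ray enters the domain
  have hin : ∀ᶠ s in 𝓝[>] (0 : ℝ), l s ∈ Ω := by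
    have h1 : HasDerivAt (fun s => φ (l s)) (-‖e‖ ^ 2) 0 := by
      have h : HasDerivAt (fun s => φ (l s)) (inner ℝ (gradient φ (l 0)) (-e)) 0 :=
        (hφd (l 0)).hasFDerivAt.comp_hasDerivAt (0 : ℝ) (hld 0)
      rwa [hl0, ← he, inner_neg_right, real_inner_self_eq_norm_sq] at h
    have h2 := (hasDerivWithinAt_iff_tendsto_slope' (s := Ioi 0) (by simp)).1
      h1.hasDerivWithinAt
    have h3 : -‖e‖ ^ 2 < 0 := by
      have := norm_pos_iff.2 (hφ.gradient_ne_zero x hx)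
      have : 0 < ‖e‖ ^ 2 := by positivity
      linarith
    filter_upwards [h2.eventually_lt_const h3, self_mem_nhdsWithin] with s hs hs0
    rw [slope_def_field, hl0, hφ0, sub_zero, sub_zero] at hs
    rw [hφ.mem_iff]
    rcases div_neg_iff.1 hs with h | h
    · exact absurd h.2 (not_lt.2 (le_of_lt hs0))
    · exact h.1
  have hlt : Filter.Tendsto l (𝓝[>] 0) (𝓝[closure Ω] x) := by
    refine tendsto_nhdsWithin_iff.2 ⟨?_, ?_⟩
    · have := (hlc.tendsto 0).mono_left (nhdsWithin_le_nhds (s := Ioi 0))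
      rwa [hl0] at this
    · filter_upwards [hin] with s hs using subset_closure hs
  have hltt : Filter.Tendsto (fun s => (l s, t)) (𝓝[>] 0) (𝓝[closure Ω ×ˢ timeIco T] (x, t)) := by
    rw [nhdsWithin_prod_eq]
    exact hlt.prodMk (tendsto_nhdsWithin_iff.2 ⟨tendsto_const_nhds, by simp [ht]⟩)
  have hut : Filter.Tendsto (fun s => u (l s) t) (𝓝[>] 0) (𝓝 (u x t)) :=
    (hG.continuousOn (x, t) ⟨hxc, ht⟩).tendsto.comp hltt
  have hGt : Filter.Tendsto (fun s => G (l s) t) (𝓝[>] 0) (𝓝 (G x t)) :=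
    (hG.continuousOn_grad (x, t) ⟨hxc, ht⟩).tendsto.comp hltt
  have hlx : Filter.Tendsto l (𝓝[>] 0) (𝓝 x) := hlt.mono_right nhdsWithin_le_nhds
  have hφt : Filter.Tendsto (fun s => φ (l s)) (𝓝[>] 0) (𝓝 (φ x)) :=
    (hφ1.continuous.tendsto x).comp hlx
  have hgt : Filter.Tendsto (fun s => gradient φ (l s)) (𝓝[>] 0) (𝓝 e) :=
    ((continuous_gradient hφ1).tendsto x).comp hlx
  have het : Filter.Tendsto (fun s => Real.exp (K * φ (l s))) (𝓝[>] 0) (𝓝 (Real.exp (K * φ x))) :=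
    (Real.continuous_exp.tendsto _).comp (hφt.const_mul K)
  have key : -(m * u x t ^ (m - 1) * inner ℝ (G x t) e)
      + A * Real.exp (K * φ x) * K * inner ℝ e e ≤ 0 := by
    refine nonpos_of_tendsto_deriv_of_le
      (f := fun s => u (l s) t ^ m - A * (1 + Real.exp (K * φ (l s))))
      (f' := fun s => -(m * u (l s) t ^ (m - 1) * inner ℝ (G (l s) t) e)
        + A * Real.exp (K * φ (l s)) * K * inner ℝ (gradient φ (l s)) e) ?_ ?_ ?_ ?_
    · change Filter.Tendsto _ _ _
      beta_reduce
      rw [hl0]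
      exact (hut.rpow_const (Or.inr (by linarith))).sub ((het.const_add 1).const_mul A)
    · filter_upwards [hin] with s hs
      have h1 : HasDerivAt (fun s => u (l s) t) (inner ℝ (G (l s) t) (-e)) s :=
        (hG.hasGradientAt (l s) hs t ht).hasFDerivAt.comp_hasDerivAt s (hld s)
      have h2 : HasDerivAt (fun s => φ (l s)) (inner ℝ (gradient φ (l s)) (-e)) s :=
        (hφd (l s)).hasFDerivAt.comp_hasDerivAt s (hld s)
      have h3 := (h1.rpow_const (p := m) (Or.inl (hpos _ hs).ne')).sub
        (((h2.const_mul K).exp.const_add 1).const_mul A)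
      refine h3.congr_deriv ?_
      simp only [inner_neg_right]
      ring
    · refine Filter.Tendsto.add (Filter.Tendsto.neg ?_) ?_
      · exact ((hut.rpow_const (Or.inr (by linarith))).const_mul m).mul
          (hGt.inner tendsto_const_nhds)
      · exact ((het.const_mul A).mul_const K).mul (hgt.inner tendsto_const_nhds)
    · filter_upwards [hin] with s hs
      rw [hl0, heq, sub_self]
      linarith [hle _ hs]
  rw [hφ0, mul_zero, Real.exp_zero, real_inner_self_eq_norm_sq] at key
  linarith

/-- **Uniform bound.** A solution stays below a barrier `(A (1 + exp (K φ))) ^ (1 / m)`. -/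
theorem IsClassicalSolution.exists_bound (hu : IsClassicalSolution Ω a b c m p q g u₀ T u)
    (hΩ : IsBoundedSmoothDomain Ω) (ha : 0 ≤ a) (hb : 0 < b) (hc : 0 ≤ c) (hk : 0 ≤ k)
    (hm : 1 < m) (hmp : m < p) (hpq : p < q) (hmpq : 2 * p < m + q)
    (hg : ∀ ξ : ℝ, 0 ≤ ξ → g ξ ≤ k * ξ ^ (p - m + 1)) :
    ∃ B : ℝ, ∀ t ∈ timeIco T, ∀ x ∈ closure Ω, u x t ≤ B := by
  obtain ⟨φ, hφ⟩ := hΩ.smooth_boundary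
  obtain ⟨G, hG, hGn⟩ := hu.regular_boundary
  have hm0 : 0 < m := by linarith
  have hcl : IsCompact (closure Ω) := hΩ.isBounded.isCompact_closure
  have hφ2 : ContDiff ℝ 2 φ := hφ.smooth.of_le (by norm_cast)
  have hφ1 : ContDiff ℝ 1 φ := hφ.smooth.of_le (by norm_cast)
  obtain ⟨c₀, hc₀, hgrad⟩ := hφ.exists_le_norm_gradient hΩ.isBounded
  obtain ⟨C, hC⟩ := hcl.exists_bound_of_continuousOn
    (f := fun x => ‖gradient φ x‖ ^ 2 + |Laplacian.laplacian φ x|)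
    (((continuous_gradient hφ1).norm.pow 2).add (continuous_laplacian hφ2).abs).continuousOn
  have hcont : ContinuousOn (fun z : EuclideanSpace ℝ (Fin N) × ℝ => u z.1 z.2 ^ m)
      (closure Ω ×ˢ timeIco T) := hG.continuousOn.rpow_const fun _ _ => Or.inr hm0.le
  have h0T : (0 : ℝ) ∈ timeIco T := ⟨le_rfl, hu.time_pos⟩
  have hcont0 : ContinuousOn (fun x => u x 0 ^ m) (closure Ω) :=
    hcont.comp (f := fun x => (x, (0 : ℝ))) (by fun_prop) fun x hx => ⟨hx, h0T⟩
  obtain ⟨A₀, hA₀⟩ := hcl.exists_bound_of_continuousOn hcont0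
  obtain ⟨A, K, hAA₀, hA, hK, hbd, hint⟩ := exists_barrier_parameters hb hm hmp hpq hmpq
    (κ₁ := m * k) (κ₂ := a * volume.real Ω) (C := C) (by positivity) hc₀ A₀
  set W : EuclideanSpace ℝ (Fin N) → ℝ := fun x => A * (1 + Real.exp (K * φ x)) with hW
  have hWc : Continuous W := by
    have := hφ1.continuous
    fun_prop
  have hWA : ∀ x, A < W x := fun x => by
    have := mul_pos hA (Real.exp_pos (K * φ x))
    simp only [hW]; linarith
  have hexp1 : ∀ x ∈ closure Ω, Real.exp (K * φ x) ≤ 1 := fun x hx => by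
    rw [Real.exp_le_one_iff]
    exact mul_nonpos_of_nonneg_of_nonpos (by linarith) (hφ.nonpos_of_mem_closure hx)
  have hW2 : ∀ x ∈ closure Ω, W x ≤ 2 * A := fun x hx => by
    have := mul_le_mul_of_nonneg_left (hexp1 x hx) hA.le
    simp only [hW]; linarith
  have hpow : ∀ {y : ℝ} (r : ℝ), 0 ≤ y → y ^ r = (y ^ m) ^ (r / m) := fun {y} r hy => by
    rw [← Real.rpow_mul hy]; congr 1; field_simp
  have main : ∀ t ∈ timeIco T, ∀ x ∈ closure Ω, u x t ^ m ≤ W x := by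
    by_contra! hcon
    obtain ⟨t₁, ht₁, x', hx', hlt⟩ := hcon
    have hsub : closure Ω ×ˢ Icc 0 t₁ ⊆ closure Ω ×ˢ timeIco T :=
      prod_mono subset_rfl fun s hs => mem_timeIco_of_le ht₁ hs.1 hs.2
    -- the first time at which the solution touches the barrier
    set S : Set (EuclideanSpace ℝ (Fin N) × ℝ) :=
      (closure Ω ×ˢ Icc 0 t₁) ∩ (fun z => u z.1 z.2 ^ m - W z.1) ⁻¹' Ici 0 with hS
    have hScl : IsClosed S := ((hcont.mono hsub).sub
      (hWc.comp continuous_fst).continuousOn).preimage_isClosed_of_isClosed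
      (isClosed_closure.prod isClosed_Icc) isClosed_Ici
    have hSc : IsCompact S := (hcl.prod isCompact_Icc).of_isClosed_subset hScl inter_subset_left
    have hSne : S.Nonempty := ⟨(x', t₁), ⟨hx', ht₁.1, le_rfl⟩, by simpa using hlt.le⟩
    obtain ⟨⟨x, t⟩, ⟨⟨hx, ht⟩, hxt⟩, hmin⟩ := hSc.exists_isMinOn hSne continuous_snd.continuousOn
    simp only at hx ht
    have hge : W x ≤ u x t ^ m := by simpa using hxt
    have hbefore : ∀ s, 0 ≤ s → s < t → ∀ y ∈ closure Ω, u y s ^ m < W y := by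
      intro s hs0 hst y hy
      by_contra! hcon
      have : t ≤ s := hmin (show (y, s) ∈ S from
        ⟨⟨hy, hs0, hst.le.trans ht.2⟩, by simpa using hcon⟩)
      linarith
    have htT : t ∈ timeIco T := mem_timeIco_of_le ht₁ ht.1 ht.2
    have ht0 : 0 < t := by
      rcases ht.1.eq_or_lt with h | h
      · have h1 := hA₀ x hx
        rw [h] at h1
        have := hWA x
        linarith [le_abs_self (u x t ^ m), Real.norm_eq_abs (u x t ^ m)]
      · exact h
    have htT' : t ∈ timeIoo T := ⟨ht0, htT.2⟩
    have hle : ∀ y ∈ closure Ω, u y t ^ m ≤ W y := by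
      intro y hy
      have h1 : ContinuousOn (fun s => u y s ^ m) (Icc 0 t) :=
        hcont.comp (f := fun s => (y, s)) (by fun_prop) fun s hs =>
          ⟨hy, mem_timeIco_of_le htT hs.1 hs.2⟩
      have h2 : ContinuousWithinAt (fun s => u y s ^ m) (Ioo 0 t) t :=
        (h1 t ⟨ht0.le, le_rfl⟩).mono Ioo_subset_Icc_self
      have : (𝓝[Ioo 0 t] t).NeBot := by
        rw [← mem_closure_iff_nhdsWithin_neBot, closure_Ioo ht0.ne]
        exact ⟨ht0.le, le_rfl⟩
      refine le_of_tendsto h2 ?_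
      filter_upwards [self_mem_nhdsWithin] with s hs
      exact (hbefore s hs.1.le hs.2 y hy).le
    have heq : u x t ^ m = W x := le_antisymm (hle x hx) hge
    have hunn : ∀ y ∈ closure Ω, 0 ≤ u y t := fun y hy => hu.nonneg hy htT
    by_cases hxΩ : x ∈ Ω
    · have hpast : ∀ s, 0 ≤ s → s < t → u x s ≤ u x t := by
        intro s hs hst
        have h1 := hbefore s hs hst x hx
        rw [← heq] at h1
        exact (Real.rpow_lt_rpow_iff (hu.nonneg hx (mem_timeIco_of_le htT hs hst.le))
          (hunn x hx) hm0).1 h1 |>.le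
      have h1 := hu.barrier_interior hΩ.isOpen hc hφ2 hxΩ htT' heq
        (fun y hy => hle y (subset_closure hy)) hpast
      have h2 : ∫ y in Ω, u y t ^ p ≤ (2 * A) ^ (p / m) * volume.real Ω := by
        refine (le_abs_self _).trans ?_
        refine norm_setIntegral_le_of_norm_le_const (f := fun y => u y t ^ p)
          hΩ.isBounded.measure_lt_top fun y hy => ?_
        have hy' := subset_closure hy
        rw [Real.norm_of_nonneg (Real.rpow_nonneg (hunn y hy') p), hpow p (hunn y hy')]
        exact Real.rpow_le_rpow (Real.rpow_nonneg (hunn y hy') m)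
          ((hle y hy').trans (hW2 y hy')) (by apply div_nonneg <;> linarith)
      have h3 : A ^ (q / m) ≤ u x t ^ q := by
        rw [hpow q (hunn x hx), heq]
        exact Real.rpow_le_rpow hA.le (hWA x).le (by apply div_nonneg <;> linarith)
      have h4 : Real.exp (K * φ x) *
          (K ^ 2 * ‖gradient φ x‖ ^ 2 + K * Laplacian.laplacian φ x) ≤ C * K ^ 2 := by
        have hCx := (le_abs_self _).trans (hC x hx)
        have e0 := Real.exp_pos (K * φ x)
        have e1 := hexp1 x hx
        have e2 : K ^ 2 * ‖gradient φ x‖ ^ 2 + K * Laplacian.laplacian φ x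
            ≤ K ^ 2 * (‖gradient φ x‖ ^ 2 + |Laplacian.laplacian φ x|) := by
          have : K * Laplacian.laplacian φ x ≤ K ^ 2 * |Laplacian.laplacian φ x| := by
            calc K * Laplacian.laplacian φ x ≤ K * |Laplacian.laplacian φ x| := by
                  gcongr; exact le_abs_self _
              _ ≤ K ^ 2 * |Laplacian.laplacian φ x| := by gcongr; nlinarith
          linarith
        have e3 : 0 ≤ K ^ 2 * (‖gradient φ x‖ ^ 2 + |Laplacian.laplacian φ x|) := by positivity
        calc _ ≤ Real.exp (K * φ x) *
              (K ^ 2 * (‖gradient φ x‖ ^ 2 + |Laplacian.laplacian φ x|)) := by gcongr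
          _ ≤ 1 * (K ^ 2 * (‖gradient φ x‖ ^ 2 + |Laplacian.laplacian φ x|)) := by gcongr
          _ ≤ C * K ^ 2 := by nlinarith [sq_nonneg K]
      have h5 := mul_le_mul_of_nonneg_left h4 hA.le
      have h6 := mul_le_mul_of_nonneg_left h2 ha
      have h7 := mul_le_mul_of_nonneg_left h3 hb.le
      linarith
    · have hxf : x ∈ frontier Ω := by rw [hΩ.isOpen.frontier_eq]; exact ⟨hx, hxΩ⟩
      have h1 := barrier_boundary hΩ.isOpen hm hφ hG hxf htT (fun y hy => hu.pos y hy t htT) heq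
        (fun y hy => hle y (subset_closure hy))
      have hn : 0 < ‖gradient φ x‖ := hc₀.trans_le (hgrad x hxf)
      have h2 : inner ℝ (G x t) (gradient φ x) = ‖gradient φ x‖ * g (u x t) := by
        have := hGn t htT x _ (hφ.isOutwardUnitNormal hxf)
        rw [inner_smul_right] at this
        rw [← this]; field_simp
      have hux := hunn x hx
      have hWx : W x = 2 * A := by
        simp [hW, hφ.eq_zero_of_mem_frontier hΩ.isOpen hxf]; ring
      have h3 : u x t ^ (m - 1) * g (u x t) ≤ k * (2 * A) ^ (p / m) := by
        calc u x t ^ (m - 1) * g (u x t) ≤ u x t ^ (m - 1) * (k * u x t ^ (p - m + 1)) := by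
              gcongr; exact hg _ hux
          _ = k * u x t ^ p := by
              have : u x t ^ p = u x t ^ (m - 1) * u x t ^ (p - m + 1) := by
                rw [← Real.rpow_add_of_nonneg hux (by linarith) (by linarith)]
                congr 1; ring
              rw [this]; ring
          _ = _ := by rw [hpow p hux, heq, hWx]
      have h4 : A * K * ‖gradient φ x‖ ≤ m * k * (2 * A) ^ (p / m) := by
        have e1 : A * K * ‖gradient φ x‖ * ‖gradient φ x‖ ≤
            m * (u x t ^ (m - 1) * g (u x t)) * ‖gradient φ x‖ := by
          rw [h2] at h1; linarith
        have e2 := le_of_mul_le_mul_right e1 hn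
        have e3 := mul_le_mul_of_nonneg_left h3 hm0.le
        linarith
      have h5 : A * K * c₀ ≤ A * K * ‖gradient φ x‖ :=
        mul_le_mul_of_nonneg_left (hgrad x hxf) (by positivity)
      linarith
  refine ⟨(2 * A) ^ (1 / m), fun t ht x hx => ?_⟩
  have hux := hu.nonneg hx ht
  have := Real.rpow_le_rpow (Real.rpow_nonneg hux m) ((main t ht x hx).trans (hW2 x hx))
    (show 0 ≤ 1 / m by positivity)
  rwa [← hpow 1 hux, Real.rpow_one] at this

theorem IsClassicalSolution.eq_top_of_isMaximalTime
    (hu : IsClassicalSolution Ω a b c m p q g u₀ T u)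
    (hΩ : IsBoundedSmoothDomain Ω) (ha : 0 ≤ a) (hb : 0 < b) (hc : 0 ≤ c) (hk : 0 ≤ k)
    (hm : 1 < m) (hmp : m < p) (hpq : p < q) (hmpq : 2 * p < m + q)
    (hg : ∀ ξ : ℝ, 0 ≤ ξ → g ξ ≤ k * ξ ^ (p - m + 1)) (hT : IsMaximalTime Ω T u) : T = ⊤ := by
  obtain ⟨B, hB⟩ := hu.exists_bound hΩ ha hb hc hk hm hmp hpq hmpq hg
  rcases hT with h | ⟨-, h⟩
  · exact h
  · obtain ⟨t, ht, x, hx, hlt⟩ := h B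
    exact absurd (hB t ht x (subset_closure hx)) (not_le.2 hlt)

end Comparison

/-! ### Elementary inequalities and cut-off functions -/

/-- The normalized form of `exists_linear_bound`, by comparing both sides with `log r`. -/
theorem rpow_mul_one_sub_rpow_le {r p n : ℝ} (hr : 0 < r) (hp : 1 ≤ p) (hn : 0 ≤ n) :
    r ^ (p + 1) * (1 - r ^ n) ≤ n / 2 * (1 - r ^ 2) := by
  have h1 : 1 - r ^ n ≤ -(n * Real.log r) := by
    have := Real.add_one_le_exp (n * Real.log r)
    rw [Real.rpow_def_of_pos hr, mul_comm (Real.log r)]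
    linarith
  have h2 : r ^ (p + 1) * (-Real.log r) ≤ r ^ 2 * (-Real.log r) := by
    rw [← Real.rpow_natCast]
    rcases le_total r 1 with h | h
    · refine mul_le_mul_of_nonneg_right ?_ (by linarith [Real.log_nonpos hr.le h])
      exact Real.rpow_le_rpow_of_exponent_ge hr h (by push_cast; linarith)
    · refine mul_le_mul_of_nonpos_right ?_ (by linarith [Real.log_nonneg h])
      exact Real.rpow_le_rpow_of_exponent_le h (by push_cast; linarith)
  have h3 : r ^ 2 * (-Real.log r) ≤ (1 - r ^ 2) / 2 := by
    have h4 := Real.log_le_sub_one_of_pos (inv_pos.2 (pow_pos hr 2))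
    rw [Real.log_inv, Real.log_pow] at h4
    have h5 := mul_le_mul_of_nonneg_left h4 (pow_pos hr 2).le
    rw [mul_sub, mul_inv_cancel₀ (pow_pos hr 2).ne'] at h5
    push_cast at h5
    linarith
  calc r ^ (p + 1) * (1 - r ^ n) ≤ r ^ (p + 1) * (-(n * Real.log r)) := by gcongr
    _ = n * (r ^ (p + 1) * (-Real.log r)) := by ring
    _ ≤ n * ((1 - r ^ 2) / 2) := by gcongr; exact h2.trans h3
    _ = n / 2 * (1 - r ^ 2) := by ring

/-- The nonlinearity `M s ^ (p + 1) - M' s ^ (q + 1)` lies below its tangent at its positive zero,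
when both are regarded as functions of `s ^ 2`. This replaces Hölder's inequality and turns the
energy inequality into a linear differential inequality for `∫ u ^ 2`. -/
theorem exists_linear_bound {p q M M' : ℝ} (hp : 1 ≤ p) (hpq : p < q) (hM : 0 < M)
    (hM' : 0 < M') :
    ∃ C > 0, ∀ s > 0, M * s ^ (p + 1) - M' * s ^ (q + 1) ≤
      C * ((M / M') ^ (2 / (q - p)) - s ^ 2) := by
  have hqp : 0 < q - p := sub_pos.2 hpq
  set l := (M / M') ^ (1 / (q - p)) with hl
  have hlpos : 0 < l := by positivity
  have hl1 : M = M' * l ^ (q - p) := by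
    rw [hl, ← Real.rpow_mul (by positivity), one_div_mul_cancel hqp.ne', Real.rpow_one]
    field_simp
  have hl2 : (M / M') ^ (2 / (q - p)) = l ^ 2 := by
    rw [hl, ← Real.rpow_natCast, ← Real.rpow_mul (by positivity)]
    congr 1; push_cast; ring
  refine ⟨M' * ((q - p) / 2) * l ^ (q - 1), by positivity, fun s hs => ?_⟩
  have key := rpow_mul_one_sub_rpow_le (div_pos hs hlpos) hp hqp.le
  rw [hl2]
  have e1 : l ^ (q + 1) * (s / l) ^ (p + 1) = l ^ (q - p) * s ^ (p + 1) := by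
    rw [Real.div_rpow hs.le hlpos.le, show q + 1 = (q - p) + (p + 1) by ring,
      Real.rpow_add hlpos]
    field_simp
  have e2 : l ^ (q - p) * (s / l) ^ (q - p) = s ^ (q - p) := by
    rw [Real.div_rpow hs.le hlpos.le]
    field_simp
  have e3 : l ^ (q + 1) = l ^ (q - 1) * l ^ 2 := by
    rw [← Real.rpow_natCast, ← Real.rpow_add hlpos]
    congr 1; push_cast; ring
  have e4 : s ^ (q + 1) = s ^ (p + 1) * s ^ (q - p) := by
    rw [← Real.rpow_add hs]
    congr 1; ring
  have e5 : l ^ (q + 1) * ((s / l) ^ (p + 1) * (1 - (s / l) ^ (q - p))) =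
      l ^ (q - p) * s ^ (p + 1) - s ^ (q + 1) := by
    rw [← mul_assoc, e1, e4, ← e2]; ring
  have e6 : l ^ (q + 1) * ((q - p) / 2 * (1 - (s / l) ^ 2)) =
      (q - p) / 2 * l ^ (q - 1) * (l ^ 2 - s ^ 2) := by
    rw [e3]; field_simp
  have := mul_le_mul_of_nonneg_left key (show 0 ≤ l ^ (q + 1) by positivity)
  rw [e5, e6] at this
  have := mul_le_mul_of_nonneg_left this hM'.le
  calc _ = M' * (l ^ (q - p) * s ^ (p + 1) - s ^ (q + 1)) := by rw [hl1]; ring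
    _ ≤ _ := this
    _ = _ := by ring

theorem alphaExp_pos {m p q : ℝ} (hpq : p < q) (hmpq : 2 * p < m + q) : 0 < alphaExp m p q :=
  div_pos (by linarith) (sub_pos.2 hpq)

theorem alphaExp_lt_one {m p q : ℝ} (hmp : m < p) (hpq : p < q) : alphaExp m p q < 1 := by
  rw [alphaExp, div_lt_one (sub_pos.2 hpq)]; linarith

/-- Young's inequality for `2 p - m + 1 = α (p + 1) + (1 - α) (q + 1)`. -/
theorem rpow_le_young {m p q ε s : ℝ} (hmp : m < p) (hpq : p < q)
    (hmpq : 2 * p < m + q) (hε : 0 < ε) (hs : 0 < s) :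
    s ^ (2 * p - m + 1) ≤
      alphaExp m p q * (ε ^ ((alphaExp m p q - 1) / alphaExp m p q) * s ^ (p + 1)) +
        (1 - alphaExp m p q) * (ε * s ^ (q + 1)) := by
  have hα := alphaExp_pos hpq hmpq
  have hα1 := alphaExp_lt_one hmp hpq
  have he : 2 * p - m + 1 = (p + 1) * alphaExp m p q + (q + 1) * (1 - alphaExp m p q) := by
    have : q - p ≠ 0 := (sub_pos.2 hpq).ne'
    rw [alphaExp]; field_simp; ring
  set α := alphaExp m p q
  have := Real.geom_mean_le_arith_mean2_weighted (w₁ := α) (w₂ := 1 - α)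
    (p₁ := ε ^ ((α - 1) / α) * s ^ (p + 1)) (p₂ := ε * s ^ (q + 1)) hα.le (by linarith)
    (by positivity) (by positivity) (by ring)
  refine le_trans (le_of_eq ?_) this
  rw [Real.mul_rpow (by positivity) (by positivity), Real.mul_rpow (by positivity) (by positivity),
    ← Real.rpow_mul hε.le, ← Real.rpow_mul hs.le, ← Real.rpow_mul hs.le, he, Real.rpow_add hs,
    div_mul_cancel₀ _ hα.ne']
  have : ε ^ (α - 1) * ε ^ (1 - α) = 1 := by
    rw [← Real.rpow_add hε]; simp
  calc _ = (ε ^ (α - 1) * ε ^ (1 - α)) * (s ^ ((p + 1) * α) * s ^ ((q + 1) * (1 - α))) := by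
        rw [this, one_mul]
    _ = _ := by ring

/-- Chebyshev's inequality for the comonotone functions `f` and `f ^ p`. -/
theorem integral_mul_integral_rpow_le {X : Type*} [MeasurableSpace X] {μ : Measure X}
    [IsFiniteMeasure μ] {f : X → ℝ} {p : ℝ} (hp : 0 < p) (hf : ∀ᵐ x ∂μ, 0 ≤ f x)
    (h1 : Integrable f μ) (h2 : Integrable (fun x => f x ^ p) μ)
    (h3 : Integrable (fun x => f x ^ (p + 1)) μ) :
    (∫ x, f x ∂μ) * (∫ x, f x ^ p ∂μ) ≤ μ.real univ * ∫ x, f x ^ (p + 1) ∂μ := by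
  rcases eq_or_ne μ 0 with rfl | hμ
  · simp
  have hV : 0 < μ.real univ := by
    have : NeZero μ := ⟨hμ⟩
    exact measureReal_univ_pos
  set V := μ.real univ
  -- integrate `0 ≤ (f ^ p - r ^ p) (f - r)` for the mean value `r` of `f`
  set r := (∫ x, f x ∂μ) / V with hr
  have hr0 : 0 ≤ r := div_nonneg (integral_nonneg_of_ae hf) hV.le
  have hrV : r * V = ∫ x, f x ∂μ := by rw [hr]; field_simp
  have hpt : ∀ᵐ x ∂μ, 0 ≤ f x ^ (p + 1) - r * f x ^ p - r ^ p * (f x - r) := by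
    filter_upwards [hf] with x hx
    have e : f x ^ (p + 1) = f x ^ p * f x := by
      rw [Real.rpow_add_of_nonneg hx hp.le zero_le_one, Real.rpow_one]
    have : f x ^ (p + 1) - r * f x ^ p - r ^ p * (f x - r) = (f x ^ p - r ^ p) * (f x - r) := by
      rw [e]; ring
    rw [this]
    rcases le_total (f x) r with h | h
    · exact mul_nonneg_of_nonpos_of_nonpos
        (sub_nonpos.2 (Real.rpow_le_rpow hx h hp.le)) (sub_nonpos.2 h)
    · exact mul_nonneg (sub_nonneg.2 (Real.rpow_le_rpow hr0 h hp.le)) (sub_nonneg.2 h)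
  have h := integral_nonneg_of_ae hpt
  have i1 : Integrable (fun x => r * f x ^ p) μ := h2.const_mul r
  have i2 : Integrable (fun x => f x ^ (p + 1) - r * f x ^ p) μ := h3.sub i1
  have i3 : Integrable (fun x => f x - r) μ := h1.sub (integrable_const r)
  rw [integral_sub i2 (i3.const_mul _), integral_sub h3 i1, integral_const_mul,
    integral_const_mul, integral_sub h1 (integrable_const r), integral_const, smul_eq_mul,
    ← hrV] at h
  change 0 ≤ _ - _ - r ^ p * (r * V - V * r) at h
  rw [← hrV]
  nlinarith

/-- A smooth function which is `0` where `-δ ≤ φ` and `1` where `φ ≤ -2δ`. -/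
noncomputable def cutoff {N : ℕ} (φ : EuclideanSpace ℝ (Fin N) → ℝ) (δ : ℝ)
    (x : EuclideanSpace ℝ (Fin N)) : ℝ :=
  Real.smoothTransition (-φ x / δ - 1)

section Cutoff

variable {N : ℕ} {Ω : Set (EuclideanSpace ℝ (Fin N))} {φ : EuclideanSpace ℝ (Fin N) → ℝ}
  {δ : ℝ} {x : EuclideanSpace ℝ (Fin N)}

theorem cutoff_nonneg : 0 ≤ cutoff φ δ x := Real.smoothTransition.nonneg _

theorem cutoff_le_one : cutoff φ δ x ≤ 1 := Real.smoothTransition.le_one _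

theorem contDiff_cutoff (hφ : ContDiff ℝ 1 φ) : ContDiff ℝ 1 (cutoff φ δ) :=
  Real.smoothTransition.contDiff.comp ((hφ.neg.div_const δ).sub contDiff_const)

theorem cutoff_eq_one (hδ : 0 < δ) (hx : φ x ≤ -(2 * δ)) : cutoff φ δ x = 1 := by
  refine Real.smoothTransition.one_of_one_le ?_
  rw [le_sub_iff_add_le, le_div_iff₀ hδ]
  linarith

theorem tsupport_cutoff_subset (hφ : Continuous φ) (hδ : 0 < δ) :
    tsupport (cutoff φ δ) ⊆ {x | φ x ≤ -δ} := by
  refine closure_minimal (fun x hx => ?_) (isClosed_le hφ continuous_const)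
  by_contra h
  have h : -δ < φ x := not_le.1 h
  refine hx (Real.smoothTransition.zero_of_nonpos ?_)
  rw [sub_nonpos, div_le_one hδ]
  linarith

theorem IsDefiningFunction.tsupport_cutoff_subset (hφ : IsDefiningFunction φ Ω) (hδ : 0 < δ) :
    tsupport (cutoff φ δ) ⊆ Ω := fun x hx =>
  hφ.mem_iff.2 (lt_of_le_of_lt (_root_.tsupport_cutoff_subset hφ.smooth.continuous hδ hx)
    (by simpa))

theorem IsDefiningFunction.hasCompactSupport_cutoff (hφ : IsDefiningFunction φ Ω)
    (hb : Bornology.IsBounded Ω) (hδ : 0 < δ) : HasCompactSupport (cutoff φ δ) :=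
  hb.isCompact_closure.of_isClosed_subset (isClosed_tsupport _)
    ((hφ.tsupport_cutoff_subset hδ).trans subset_closure)

/-- The gradient of the cut-off function is a nonpositive multiple of `∇ φ`, and vanishes outside
the boundary layer `-2δ ≤ φ`. -/
theorem exists_hasFDerivAt_cutoff (hφ : ContDiff ℝ 1 φ) (hδ : 0 < δ)
    (x : EuclideanSpace ℝ (Fin N)) :
    ∃ ψ : ℝ, 0 ≤ ψ ∧ (ψ ≠ 0 → -(2 * δ) ≤ φ x) ∧
      HasFDerivAt (cutoff φ δ) ((-ψ) • fderiv ℝ φ x) x := by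
  have h1 : HasDerivAt Real.smoothTransition (deriv Real.smoothTransition (-φ x / δ - 1))
      (-φ x / δ - 1) :=
    ((Real.smoothTransition.contDiff (n := 1)).differentiable (by norm_num) _).hasDerivAt
  have h2 : HasFDerivAt (fun x => -φ x * δ⁻¹ - 1) (δ⁻¹ • (-fderiv ℝ φ x)) x :=
    (((hφ.differentiable (by norm_num) x).hasFDerivAt.neg).mul_const δ⁻¹).sub_const 1
  refine ⟨deriv Real.smoothTransition (-φ x / δ - 1) * δ⁻¹,
    mul_nonneg Real.smoothTransition.monotone.deriv_nonneg (inv_pos.2 hδ).le, fun h => ?_, ?_⟩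
  · by_contra! hlt
    refine h ?_
    have h3 : Real.smoothTransition =ᶠ[𝓝 (-φ x / δ - 1)] fun _ => 1 := by
      have : 1 < -φ x / δ - 1 := by
        rw [lt_sub_iff_add_lt, lt_div_iff₀ hδ]; linarith
      filter_upwards [lt_mem_nhds this] with y hy
      exact Real.smoothTransition.one_of_one_le hy.le
    rw [h3.deriv_eq]; simp
  · have h3 := h1.comp_hasFDerivAt x (f := fun x => -φ x * δ⁻¹ - 1) h2
    refine h3.congr_fderiv ?_
    ext v
    simp
    ring

/-- A strict inequality on the boundary, uniform in a compact time interval, persists in a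
boundary layer. -/
theorem IsDefiningFunction.exists_layer (hφ : IsDefiningFunction φ Ω)
    (hb : Bornology.IsBounded Ω) {s t : ℝ} {F : EuclideanSpace ℝ (Fin N) × ℝ → ℝ}
    (hF : ContinuousOn F (closure Ω ×ˢ Icc s t))
    (hpos : ∀ x ∈ frontier Ω, ∀ τ ∈ Icc s t, 0 < F (x, τ)) :
    ∃ δ > 0, ∀ x ∈ Ω, -δ ≤ φ x → ∀ τ ∈ Icc s t, 0 < F (x, τ) := by
  set S := (closure Ω ×ˢ Icc s t) ∩ F ⁻¹' Iic 0 with hS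
  have hScl : IsClosed S :=
    hF.preimage_isClosed_of_isClosed (isClosed_closure.prod isClosed_Icc) isClosed_Iic
  have hSc : IsCompact S :=
    (hb.isCompact_closure.prod isCompact_Icc).of_isClosed_subset hScl inter_subset_left
  rcases S.eq_empty_or_nonempty with h | h
  · refine ⟨1, one_pos, fun x hx _ τ hτ => ?_⟩
    by_contra! hle
    have : (x, τ) ∈ S := ⟨⟨subset_closure hx, hτ⟩, hle⟩
    rw [h] at this
    exact this
  · obtain ⟨z, hz, hmax⟩ := hSc.exists_isMaxOn h
      (hφ.smooth.continuous.comp continuous_fst).continuousOn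
    have hzΩ : z.1 ∈ Ω := by
      by_contra hn
      exact absurd (hpos z.1 ⟨hz.1.1, fun h => hn (interior_subset h)⟩ z.2 hz.1.2)
        (not_lt.2 hz.2)
    have hz0 := hφ.mem_iff.1 hzΩ
    refine ⟨-φ z.1 / 2, by linarith, fun x hx hlt τ hτ => ?_⟩
    by_contra! hle
    have : φ x ≤ φ z.1 := hmax (show (x, τ) ∈ S from ⟨⟨subset_closure hx, hτ⟩, hle⟩)
    linarith

end Cutoff

/-! ### The energy estimate at a fixed time -/

section Localization

variable {N : ℕ} {Ω : Set (EuclideanSpace ℝ (Fin N))} {η X : EuclideanSpace ℝ (Fin N) → ℝ}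

theorem contDiff_mul_of_tsupport_subset (hΩ : IsOpen Ω) (hη : ContDiff ℝ 1 η)
    (hηΩ : tsupport η ⊆ Ω) (hX : ContDiffOn ℝ 1 X Ω) : ContDiff ℝ 1 fun x => η x * X x := by
  refine contDiff_iff_contDiffAt.2 fun x => ?_
  by_cases hx : x ∈ tsupport η
  · exact hη.contDiffAt.mul (hX.contDiffAt (hΩ.mem_nhds (hηΩ hx)))
  · refine (contDiffAt_const (c := (0 : ℝ))).congr_of_eventuallyEq ?_
    filter_upwards [notMem_tsupport_iff_eventuallyEq.1 hx] with y hy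
    simp [hy]

theorem integrable_mul_of_tsupport_subset (hΩ : IsOpen Ω) (hη : Continuous η)
    (hηΩ : tsupport η ⊆ Ω) (hηc : HasCompactSupport η) (hX : ContinuousOn X Ω) :
    Integrable fun x => η x * X x := by
  refine Continuous.integrable_of_hasCompactSupport ?_ (hηc.mul_right (f' := X))
  refine continuous_of_tsupport fun x hx => ?_
  exact hη.continuousAt.mul
    (hX.continuousAt (hΩ.mem_nhds (hηΩ (tsupport_mul_subset_left hx))))

theorem setIntegral_mul_of_tsupport_subset (hηΩ : tsupport η ⊆ Ω) :
    ∫ x in Ω, η x * X x = ∫ x, η x * X x := by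
  refine setIntegral_eq_integral_of_forall_compl_eq_zero fun x hx => ?_
  rw [image_eq_zero_of_notMem_tsupport fun h => hx (hηΩ h), zero_mul]

end Localization

theorem continuousOn_laplacian {N : ℕ} {Ω : Set (EuclideanSpace ℝ (Fin N))}
    {w : EuclideanSpace ℝ (Fin N) → ℝ} (hΩ : IsOpen Ω) (hw : ContDiffOn ℝ 2 w Ω) :
    ContinuousOn (Laplacian.laplacian w) Ω := by
  have h1 : ContinuousOn (fun x => ∑ i, fderiv ℝ
      (fun y => fderiv ℝ w y (EuclideanSpace.single i 1)) x (EuclideanSpace.single i 1)) Ω :=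
    continuousOn_finsetSum _ fun i _ =>
      (((hw.fderiv_of_isOpen (m := 1) hΩ (by norm_num)).clm_apply
        contDiffOn_const).continuousOn_fderiv_of_isOpen hΩ (by norm_num)).clm_apply
        continuousOn_const
  exact h1.congr fun x hx => laplacian_eq_sum_fderiv ((hw x hx).contDiffAt (hΩ.mem_nhds hx))

theorem sum_mul_eq_inner {N : ℕ} (x y : EuclideanSpace ℝ (Fin N)) :
    ∑ i, x i * y i = inner ℝ x y := by
  simp [PiLp.inner_apply, mul_comm]

/-- The pointwise inequality behind the energy estimate. The right-hand side is the divergence of the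
field `η (2 v ∇ v ^ m - (2 m / ρ) (k v ^ (p + 1) + κ) z)`, where `z = x - x₀`, `∇ η = -ψ n`, `v` has
gradient `γ`, and `L = Δ v ^ m`. The terms with `ψ` are nonnegative, and the dissipation absorbs the
term with `⟪γ, z⟫`. -/
theorem divergence_lower_bound {E : Type*} [NormedAddCommGroup E] [InnerProductSpace ℝ E]
    {n γ z : E} {η ψ v k m p ρ d κ L : ℝ} {N : ℕ} (hη : 0 ≤ η) (hψ : 0 ≤ ψ) (hv : 0 < v)
    (hk : 0 ≤ k) (hm : 0 < m) (hp : 0 < p) (hρ : 0 < ρ) (hz : ‖z‖ ≤ d)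
    (hstar : ψ ≠ 0 → ρ * ‖n‖ ≤ inner ℝ z n)
    (hflux : ψ ≠ 0 → v ^ m * inner ℝ γ n ≤ (k * v ^ (p + 1) + κ) * ‖n‖)
    (hκ : 0 ≤ κ) :
    η * (2 * v * L) - η * (2 * k * N * m / ρ * v ^ (p + 1)
        + m * k ^ 2 * (p + 1) ^ 2 * d ^ 2 / (2 * ρ ^ 2) * v ^ (2 * p - m + 1)
        + 2 * m * N * κ / ρ) ≤
      -ψ * (2 * v * (m * v ^ (m - 1)) * inner ℝ γ n
          - 2 * m / ρ * (k * v ^ (p + 1) + κ) * inner ℝ z n)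
        + η * (2 * m * v ^ (m - 1) * ‖γ‖ ^ 2 + 2 * v * L
          - 2 * m / ρ * (k * (p + 1) * v ^ p * inner ℝ γ z + N * (k * v ^ (p + 1) + κ))) := by
  have hvm : v * v ^ (m - 1) = v ^ m := by
    rw [Real.rpow_sub hv, Real.rpow_one]; field_simp
  have h1 : 0 ≤ -ψ * (2 * v * (m * v ^ (m - 1)) * inner ℝ γ n
      - 2 * m / ρ * (k * v ^ (p + 1) + κ) * inner ℝ z n) := by
    rcases eq_or_ne ψ 0 with h | h
    · simp [h]
    · have hb : 0 ≤ k * v ^ (p + 1) + κ := by positivity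
      have e1 : 2 * v * (m * v ^ (m - 1)) * inner ℝ γ n = 2 * m * (v ^ m * inner ℝ γ n) := by
        rw [← hvm]; ring
      have e2 : v ^ m * inner ℝ γ n * ρ ≤ (k * v ^ (p + 1) + κ) * inner ℝ z n := by
        calc v ^ m * inner ℝ γ n * ρ ≤ (k * v ^ (p + 1) + κ) * ‖n‖ * ρ :=
              mul_le_mul_of_nonneg_right (hflux h) hρ.le
          _ = (k * v ^ (p + 1) + κ) * (ρ * ‖n‖) := by ring
          _ ≤ _ := by gcongr; exact hstar h
      have e3 : v ^ m * inner ℝ γ n ≤ (k * v ^ (p + 1) + κ) * inner ℝ z n / ρ := by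
        rwa [le_div_iff₀ hρ]
      have e4 : 2 * m / ρ * (k * v ^ (p + 1) + κ) * inner ℝ z n
          = 2 * m * ((k * v ^ (p + 1) + κ) * inner ℝ z n / ρ) := by ring
      rw [e1, e4]
      have := mul_le_mul_of_nonneg_left e3 (show 0 ≤ 2 * m by positivity)
      exact mul_nonneg_of_nonpos_of_nonpos (by linarith) (by linarith)
  have h2 : k * (p + 1) * v ^ p * inner ℝ γ z / ρ ≤ v ^ (m - 1) * ‖γ‖ ^ 2
      + k ^ 2 * (p + 1) ^ 2 * d ^ 2 / (4 * ρ ^ 2) * v ^ (2 * p - m + 1) := by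
    have hd : 0 ≤ d := (norm_nonneg z).trans hz
    have e1 : inner ℝ γ z ≤ ‖γ‖ * d :=
      (real_inner_le_norm γ z).trans (by gcongr)
    set s := v ^ ((m - 1) / 2)
    set r := v ^ ((2 * p - m + 1) / 2)
    have e2 : s ^ 2 = v ^ (m - 1) := by
      rw [← Real.rpow_natCast, ← Real.rpow_mul hv.le]; congr 1; push_cast; ring
    have e3 : r ^ 2 = v ^ (2 * p - m + 1) := by
      rw [← Real.rpow_natCast, ← Real.rpow_mul hv.le]; congr 1; push_cast; ring
    have e4 : s * r = v ^ p := by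
      rw [← Real.rpow_add hv]; congr 1; ring
    rw [← e2, ← e3, ← e4]
    calc k * (p + 1) * (s * r) * inner ℝ γ z / ρ ≤ k * (p + 1) * (s * r) * (‖γ‖ * d) / ρ := by
          gcongr
      _ = 2 * (s * ‖γ‖) * (k * (p + 1) * d / (2 * ρ) * r) := by ring
      _ ≤ (s * ‖γ‖) ^ 2 + (k * (p + 1) * d / (2 * ρ) * r) ^ 2 := two_mul_le_add_sq _ _
      _ = _ := by ring
  have h3 := mul_le_mul_of_nonneg_left h2 (show 0 ≤ η * (2 * m) by positivity)
  have h4 : η * (2 * m * v ^ (m - 1) * ‖γ‖ ^ 2 + 2 * v * L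
      - 2 * m / ρ * (k * (p + 1) * v ^ p * inner ℝ γ z + N * (k * v ^ (p + 1) + κ)))
      - (η * (2 * v * L) - η * (2 * k * N * m / ρ * v ^ (p + 1)
        + m * k ^ 2 * (p + 1) ^ 2 * d ^ 2 / (2 * ρ ^ 2) * v ^ (2 * p - m + 1)
        + 2 * m * N * κ / ρ)) =
      η * (2 * m) * (v ^ (m - 1) * ‖γ‖ ^ 2
        + k ^ 2 * (p + 1) ^ 2 * d ^ 2 / (4 * ρ ^ 2) * v ^ (2 * p - m + 1))
      - η * (2 * m) * (k * (p + 1) * v ^ p * inner ℝ γ z / ρ) := by ring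
  linarith

/-- **Energy estimate at a fixed time.** The boundary flux of `v ^ m` is controlled near the
boundary by the star-shapedness; the integral form only involves a cut-off function. -/
theorem integral_mul_laplacian_le {N : ℕ} {Ω : Set (EuclideanSpace ℝ (Fin N))}
    {φ v : EuclideanSpace ℝ (Fin N) → ℝ} {x₀ : EuclideanSpace ℝ (Fin N)}
    {k m p ρ d κ δ : ℝ} (hφ : IsDefiningFunction φ Ω) (hΩ : IsOpen Ω)
    (hb : Bornology.IsBounded Ω) (hδ : 0 < δ) (hv : ContDiffOn ℝ 2 v Ω) (hpos : ∀ x ∈ Ω, 0 < v x)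
    (hk : 0 ≤ k) (hm : 0 < m) (hp : 0 < p) (hρ : 0 < ρ) (hκ : 0 ≤ κ)
    (hd : ∀ x ∈ Ω, ‖x - x₀‖ ≤ d)
    (hstar : ∀ x ∈ Ω, -(2 * δ) ≤ φ x → ρ * ‖gradient φ x‖ ≤ inner ℝ (x - x₀) (gradient φ x))
    (hflux : ∀ x ∈ Ω, -(2 * δ) ≤ φ x → v x ^ m * inner ℝ (gradient v x) (gradient φ x) ≤
      (k * v x ^ (p + 1) + κ) * ‖gradient φ x‖) :
    ∫ x, cutoff φ δ x * (2 * v x * Laplacian.laplacian (fun y => v y ^ m) x) ≤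
      ∫ x, cutoff φ δ x * (2 * k * N * m / ρ * v x ^ (p + 1)
        + m * k ^ 2 * (p + 1) ^ 2 * d ^ 2 / (2 * ρ ^ 2) * v x ^ (2 * p - m + 1)
        + 2 * m * N * κ / ρ) := by
  set η := cutoff φ δ with hηdef
  set e : Fin N → EuclideanSpace ℝ (Fin N) := fun i => EuclideanSpace.single i 1 with he
  have hφ1 : ContDiff ℝ 1 φ := hφ.smooth.of_le (by norm_cast)
  have hη1 : ContDiff ℝ 1 η := contDiff_cutoff hφ1
  have hηΩ : tsupport η ⊆ Ω := hφ.tsupport_cutoff_subset hδ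
  have hηc : HasCompactSupport η := hφ.hasCompactSupport_cutoff hb hδ
  have hw : ContDiffOn ℝ 2 (fun y => v y ^ m) Ω := fun x hx =>
    (hv x hx).rpow_const_of_ne (hpos x hx).ne'
  have hwi : ∀ i, ContDiffOn ℝ 1 (fun y => fderiv ℝ (fun y => v y ^ m) y (e i)) Ω := fun i =>
    (hw.fderiv_of_isOpen hΩ (by norm_num)).clm_apply contDiffOn_const
  have hb1 : ContDiffOn ℝ 1 (fun y => k * v y ^ (p + 1) + κ) Ω := fun x hx =>
    ((((hv x hx).of_le (by norm_num)).rpow_const_of_ne (hpos x hx).ne').const_smul k).add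
      contDiffWithinAt_const
  -- the vector field which is integrated
  set Z : Fin N → EuclideanSpace ℝ (Fin N) → ℝ := fun i y =>
    2 * v y * fderiv ℝ (fun y => v y ^ m) y (e i)
      - 2 * m / ρ * (k * v y ^ (p + 1) + κ) * (y - x₀) i with hZ
  have hZ1 : ∀ i, ContDiffOn ℝ 1 (Z i) Ω := fun i => by
    have h1 : ContDiffOn ℝ 1 v Ω := hv.of_le (by norm_num)
    have h2 : ContDiffOn ℝ 1 (fun y : EuclideanSpace ℝ (Fin N) => (y - x₀) i) Ω := by
      fun_prop
    exact ((contDiffOn_const.mul h1).mul (hwi i)).sub ((contDiffOn_const.mul hb1).mul h2)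
  have hF1 : ∀ i, ContDiff ℝ 1 fun x => η x * Z i x := fun i =>
    contDiff_mul_of_tsupport_subset hΩ hη1 hηΩ (hZ1 i)
  have hFc : ∀ i, HasCompactSupport fun x => η x * Z i x := fun i => hηc.mul_right (f' := Z i)
  have hFi : ∀ i, Integrable fun x => fderiv ℝ (fun x => η x * Z i x) x (e i) := fun i =>
    (((hF1 i).continuous_fderiv (by norm_num)).clm_apply
      continuous_const).integrable_of_hasCompactSupport ((hFc i).fderiv_apply (𝕜 := ℝ) (e i))
  have hdiv : ∫ x, ∑ i, fderiv ℝ (fun x => η x * Z i x) x (e i) = 0 := by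
    rw [integral_finsetSum _ fun i _ => hFi i]
    exact Finset.sum_eq_zero fun i _ =>
      integral_fderiv_eq_zero_of_hasCompactSupport (hF1 i) (hFc i) (e i)
  have hvc : ContinuousOn v Ω := hv.continuousOn
  have hvr : ∀ r : ℝ, ContinuousOn (fun x => v x ^ r) Ω := fun r =>
    hvc.rpow_const fun x hx => Or.inl (hpos x hx).ne'
  have hlapc : ContinuousOn (Laplacian.laplacian fun y => v y ^ m) Ω :=
    continuousOn_laplacian hΩ hw
  have hI1 : Integrable fun x => η x * (2 * v x * Laplacian.laplacian (fun y => v y ^ m) x) :=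
    integrable_mul_of_tsupport_subset hΩ hη1.continuous hηΩ hηc
      ((continuousOn_const.mul hvc).mul hlapc)
  have hI2 : Integrable fun x => η x * (2 * k * N * m / ρ * v x ^ (p + 1)
        + m * k ^ 2 * (p + 1) ^ 2 * d ^ 2 / (2 * ρ ^ 2) * v x ^ (2 * p - m + 1)
        + 2 * m * N * κ / ρ) :=
    integrable_mul_of_tsupport_subset hΩ hη1.continuous hηΩ hηc
      (((continuousOn_const.mul (hvr _)).add (continuousOn_const.mul (hvr _))).add
        continuousOn_const)
  rw [← sub_nonpos, ← integral_sub hI1 hI2, ← hdiv]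
  refine integral_mono (hI1.sub hI2) (integrable_finsetSum _ fun i _ => hFi i) fun x => ?_
  by_cases hx : x ∈ tsupport η
  swap
  · have hη0 : η x = 0 := image_eq_zero_of_notMem_tsupport hx
    have : ∀ i, fderiv ℝ (fun x => η x * Z i x) x (e i) = 0 := fun i => by
      have h1 : (fun x => η x * Z i x) =ᶠ[𝓝 x] fun _ => 0 := by
        filter_upwards [notMem_tsupport_iff_eventuallyEq.1 hx] with y hy
        simp [hy]
      rw [h1.fderiv_eq]; simp
    simp [this, hη0]
  have hxΩ := hηΩ hx
  have hvx := hpos x hxΩ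
  obtain ⟨ψ, hψ0, hψ, hηd⟩ := exists_hasFDerivAt_cutoff hφ1 hδ x
  rw [← hηdef] at hηd
  have hvd : HasFDerivAt v (fderiv ℝ v x) x :=
    (((hv x hxΩ).contDiffAt (hΩ.mem_nhds hxΩ)).differentiableAt (by norm_num)).hasFDerivAt
  have hwd : fderiv ℝ (fun y => v y ^ m) x = (m * v x ^ (m - 1)) • fderiv ℝ v x :=
    (hvd.rpow_const (Or.inl hvx.ne')).fderiv
  have hbd : HasFDerivAt (fun y => k * v y ^ (p + 1) + κ)
      (k • (((p + 1) * v x ^ (p + 1 - 1)) • fderiv ℝ v x)) x :=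
    ((hvd.rpow_const (Or.inl hvx.ne')).const_mul k).add_const κ
  have hcomp : ∀ i, fderiv ℝ (fun x => η x * Z i x) x (e i) =
      -ψ * (2 * v x * (m * v x ^ (m - 1)) * (gradient v x i * gradient φ x i)
          - 2 * m / ρ * (k * v x ^ (p + 1) + κ) * ((x - x₀) i * gradient φ x i))
        + η x * (2 * m * v x ^ (m - 1) * (gradient v x i * gradient v x i)
          + 2 * v x * fderiv ℝ (fun y => fderiv ℝ (fun y => v y ^ m) y (e i)) x (e i)
          - 2 * m / ρ * (k * (p + 1) * v x ^ p * (gradient v x i * (x - x₀) i)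
            + (k * v x ^ (p + 1) + κ))) := by
    intro i
    have h1 : HasFDerivAt (fun y => fderiv ℝ (fun y => v y ^ m) y (e i))
        (fderiv ℝ (fun y => fderiv ℝ (fun y => v y ^ m) y (e i)) x) x :=
      (((hwi i) x hxΩ).contDiffAt (hΩ.mem_nhds hxΩ)).differentiableAt (by norm_num) |>.hasFDerivAt
    have h2 : HasFDerivAt (fun y : EuclideanSpace ℝ (Fin N) => (y - x₀) i)
        (EuclideanSpace.proj i : EuclideanSpace ℝ (Fin N) →L[ℝ] ℝ) x := by
      have h := ((EuclideanSpace.proj i : EuclideanSpace ℝ (Fin N) →L[ℝ] ℝ).hasFDerivAt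
        (x := x - x₀)).comp x (f := fun y => y - x₀) ((hasFDerivAt_id x).sub_const x₀)
      rw [ContinuousLinearMap.comp_id] at h
      exact h
    have h3 : HasFDerivAt (fun x => η x * Z i x) _ x :=
      hηd.mul (((hvd.const_mul 2).mul h1).sub ((hbd.const_mul (2 * m / ρ)).mul h2))
    rw [h3.fderiv, gradient_apply, gradient_apply, hwd, add_sub_cancel_right]
    have hproj : (EuclideanSpace.proj i : EuclideanSpace ℝ (Fin N) →L[ℝ] ℝ) (e i) = 1 := by
      simp [he]
    simp only [hZ, hwd, add_apply, sub_apply, smul_apply, smul_eq_mul, hproj, PiLp.sub_apply]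
    simp only [he]
    ring
  have hsum : ∑ i, fderiv ℝ (fun x => η x * Z i x) x (e i) =
      -ψ * (2 * v x * (m * v x ^ (m - 1)) * inner ℝ (gradient v x) (gradient φ x)
          - 2 * m / ρ * (k * v x ^ (p + 1) + κ) * inner ℝ (x - x₀) (gradient φ x))
        + η x * (2 * m * v x ^ (m - 1) * ‖gradient v x‖ ^ 2
          + 2 * v x * Laplacian.laplacian (fun y => v y ^ m) x
          - 2 * m / ρ * (k * (p + 1) * v x ^ p * inner ℝ (gradient v x) (x - x₀)
            + N * (k * v x ^ (p + 1) + κ))) := by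
    rw [← real_inner_self_eq_norm_sq, ← sum_mul_eq_inner, ← sum_mul_eq_inner, ← sum_mul_eq_inner,
      ← sum_mul_eq_inner, laplacian_eq_sum_fderiv ((hw x hxΩ).contDiffAt (hΩ.mem_nhds hxΩ)),
      Finset.sum_congr rfl fun i _ => hcomp i]
    simp only [Finset.sum_add_distrib, Finset.sum_sub_distrib, ← Finset.mul_sum, Finset.sum_const,
      Finset.card_univ, Fintype.card_fin, nsmul_eq_mul, he]
    ring
  rw [hsum]
  exact divergence_lower_bound cutoff_nonneg hψ0 hvx hk hm hp hρ (hd x hxΩ)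
    (fun h => hstar x hxΩ (hψ h)) (fun h => hflux x hxΩ (hψ h)) hκ

/-! ### The localized energy -/

section Energy

variable {N : ℕ} {Ω : Set (EuclideanSpace ℝ (Fin N))} {a b c k m p q : ℝ} {g : ℝ → ℝ}
  {u₀ : EuclideanSpace ℝ (Fin N) → ℝ} {T : EReal} {u : EuclideanSpace ℝ (Fin N) → ℝ → ℝ}

theorem IsClassicalSolution.continuousOn_closure
    (hu : IsClassicalSolution Ω a b c m p q g u₀ T u) {t : ℝ} (ht : t ∈ timeIco T) :
    ContinuousOn (fun x => u x t) (closure Ω) := by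
  obtain ⟨G, hG, -⟩ := hu.regular_boundary
  exact hG.continuousOn.comp (f := fun x => (x, t)) (by fun_prop) fun x hx => ⟨hx, ht⟩

theorem IsClassicalSolution.integrableOn_rpow
    (hu : IsClassicalSolution Ω a b c m p q g u₀ T u) (hb : Bornology.IsBounded Ω) {t r : ℝ}
    (ht : t ∈ timeIco T) (hr : 0 ≤ r) : IntegrableOn (fun x => u x t ^ r) Ω :=
  (((hu.continuousOn_closure ht).rpow_const fun _ _ => Or.inr hr).integrableOn_compact
    hb.isCompact_closure).mono_set subset_closure

/-- Differentiation under the integral sign; a cut-off is needed because `u_t` is only controlled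
on compact subsets of `Ω`. -/
theorem IsClassicalSolution.hasDerivAt_integral
    (hu : IsClassicalSolution Ω a b c m p q g u₀ T u) (hΩ : IsOpen Ω)
    {η : EuclideanSpace ℝ (Fin N) → ℝ} (hη : Continuous η) (hηΩ : tsupport η ⊆ Ω)
    (hηc : HasCompactSupport η) {t : ℝ} (ht : t ∈ timeIoo T) :
    Integrable (fun x => η x * (2 * u x t * deriv (u x) t)) ∧
    HasDerivAt (fun s => ∫ x, η x * u x s ^ 2) (∫ x, η x * (2 * u x t * deriv (u x) t)) t := by
  obtain ⟨G, hG, -⟩ := hu.regular_boundary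
  obtain ⟨r, hr, hball⟩ := Metric.nhds_basis_closedBall.mem_iff.1 ((isOpen_timeIoo T).mem_nhds ht)
  rw [Real.closedBall_eq_Icc] at hball
  have hcu : ContinuousOn (fun z : EuclideanSpace ℝ (Fin N) × ℝ => u z.1 z.2) (Ω ×ˢ timeIoo T) :=
    hG.continuousOn.mono (prod_mono subset_closure fun s hs => mem_timeIco_of_mem_timeIoo hs)
  have hcd : ContinuousOn
      (fun z : EuclideanSpace ℝ (Fin N) × ℝ => η z.1 * (2 * u z.1 z.2 * deriv (u z.1) z.2))
      (Ω ×ˢ timeIoo T) :=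
    (hη.comp continuous_fst).continuousOn.mul
      ((continuousOn_const.mul hcu).mul hu.regular_interior.continuousOn_time)
  obtain ⟨C, hC⟩ := (hηc.isCompact.prod isCompact_Icc).exists_bound_of_continuousOn
    (hcd.mono (prod_mono hηΩ hball))
  have hslice : ∀ s ∈ timeIoo T, ContinuousOn (fun x => u x s) Ω := fun s hs =>
    hcu.comp (f := fun x => (x, s)) (by fun_prop) fun x hx => ⟨hx, hs⟩
  have hsliced : ContinuousOn (fun x => 2 * u x t * deriv (u x) t) Ω :=
    (continuousOn_const.mul (hslice t ht)).mul
      (hu.regular_interior.continuousOn_time.comp (f := fun x => (x, t)) (by fun_prop)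
        fun x hx => ⟨hx, ht⟩)
  have hint : ∀ s ∈ timeIoo T, Integrable fun x => η x * u x s ^ 2 := fun s hs =>
    integrable_mul_of_tsupport_subset hΩ hη hηΩ hηc ((hslice s hs).pow 2)
  have hint' : Integrable fun x => η x * (2 * u x t * deriv (u x) t) :=
    integrable_mul_of_tsupport_subset hΩ hη hηΩ hηc hsliced
  refine hasDerivAt_integral_of_dominated_loc_of_deriv_le
    (F := fun s x => η x * u x s ^ 2) (F' := fun s x => η x * (2 * u x s * deriv (u x) s))
    (bound := (tsupport η).indicator fun _ => C)
    (Icc_mem_nhds (sub_lt_self t hr) (lt_add_of_pos_right t hr)) ?_ (hint t ht)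
    hint'.aestronglyMeasurable ?_ ?_ ?_
  · filter_upwards [(isOpen_timeIoo T).mem_nhds ht] with s hs using (hint s hs).aestronglyMeasurable
  · refine Filter.Eventually.of_forall fun x s hs => ?_
    by_cases hx : x ∈ tsupport η
    · rw [indicator_of_mem hx]
      exact hC (x, s) ⟨hx, hs⟩
    · rw [indicator_of_notMem hx, image_eq_zero_of_notMem_tsupport hx]
      simp
  · exact (integrableOn_const hηc.isCompact.measure_lt_top.ne).integrable_indicator
      (isClosed_tsupport η).measurableSet
  · refine Filter.Eventually.of_forall fun x s hs => ?_
    by_cases hx : x ∈ tsupport η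
    · have h1 := (hu.regular_interior.differentiableAt_time x (hηΩ hx) s (hball hs)).hasDerivAt
      refine ((h1.pow 2).const_mul (η x)).congr_deriv ?_
      simp
    · rw [image_eq_zero_of_notMem_tsupport hx]
      simpa using hasDerivAt_const s (0 : ℝ)

/-- The constant that completing the square produces, in terms of `σ`. -/
theorem sigmaConst_identity {ρ d : ℝ} (hm : 0 < m) (hρ : 0 < ρ) :
    8 * m * sigmaConst k m p ρ d ^ 2 / (m + 1) ^ 2 =
      m * k ^ 2 * (p + 1) ^ 2 * d ^ 2 / (2 * ρ ^ 2) := by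
  have : m + 1 ≠ 0 := by positivity
  rw [sigmaConst]
  field_simp
  ring

/-- Differential inequality for the localized energy: up to errors produced by the slack `κ` in
the boundary condition and by the boundary layer, `d/dt ∫ η u ^ 2` is at most
`M₁ ∫ u ^ (p + 1) - M₂ ∫ u ^ (q + 1)`. -/
theorem IsClassicalSolution.integral_cutoff_le
    (hu : IsClassicalSolution Ω a b c m p q g u₀ T u) (hΩ : IsOpen Ω)
    (hbd : Bornology.IsBounded Ω) {φ : EuclideanSpace ℝ (Fin N) → ℝ}
    (hφ : IsDefiningFunction φ Ω) {x₀ : EuclideanSpace ℝ (Fin N)} {ρ d κ δ ε B t : ℝ}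
    (ha : 0 ≤ a) (hc : 0 ≤ c) (hk : 0 ≤ k) (hm : 1 < m) (hmp : m < p) (hpq : p < q)
    (hmpq : 2 * p < m + q) (hδ : 0 < δ) (hρ : 0 < ρ) (hκ : 0 ≤ κ) (hε : 0 < ε)
    (hM₂ : 0 < M₂ b k m p q ρ d ε) (ht : t ∈ timeIoo T) (hB : ∀ x ∈ Ω, u x t ≤ B)
    (hd : ∀ x ∈ Ω, ‖x - x₀‖ ≤ d)
    (hstar : ∀ x ∈ Ω, -(2 * δ) ≤ φ x → ρ * ‖gradient φ x‖ ≤ inner ℝ (x - x₀) (gradient φ x))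
    (hflux : ∀ x ∈ Ω, -(2 * δ) ≤ φ x →
      u x t ^ m * inner ℝ (gradient (fun y => u y t) x) (gradient φ x) ≤
        (k * u x t ^ (p + 1) + κ) * ‖gradient φ x‖) :
    ∫ x, cutoff φ δ x * (2 * u x t * deriv (u x) t) ≤
      (∫ x in Ω, (M₁ N (volume.real Ω) a k m p q ρ d ε * u x t ^ (p + 1)
        - M₂ b k m p q ρ d ε * u x t ^ (q + 1)))
      + 2 * m * N * κ / ρ * volume.real Ω
      + M₂ b k m p q ρ d ε * B ^ (q + 1) * ∫ x in Ω, (1 - cutoff φ δ x) := by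
  have ht' := mem_timeIco_of_mem_timeIoo ht
  have hpos : ∀ x ∈ Ω, 0 < u x t := fun x hx => hu.pos x hx t ht'
  have hη1 : ContDiff ℝ 1 (cutoff φ δ) := contDiff_cutoff (hφ.smooth.of_le (by norm_cast))
  have hηΩ : tsupport (cutoff φ δ) ⊆ Ω := hφ.tsupport_cutoff_subset hδ
  have hηc : HasCompactSupport (cutoff φ δ) := hφ.hasCompactSupport_cutoff hbd hδ
  have hv := hu.regular_interior.contDiffOn_space t ht
  have hvc : ContinuousOn (fun x => u x t) Ω := hv.continuousOn
  have hvr : ∀ r : ℝ, ContinuousOn (fun x => u x t ^ r) Ω := fun r =>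
    hvc.rpow_const fun x hx => Or.inl (hpos x hx).ne'
  set I := ∫ x in Ω, u x t ^ p with hI
  have hI0 : 0 ≤ I := setIntegral_nonneg hΩ.measurableSet fun x hx =>
    Real.rpow_nonneg (hpos x hx).le p
  set V := volume.real Ω with hV
  set m₁ := M₁ N V a k m p q ρ d ε with hm₁
  set m₂ := M₂ b k m p q ρ d ε with hm₂
  set η := cutoff φ δ with hη
  set c₂ := m * k ^ 2 * (p + 1) ^ 2 * d ^ 2 / (2 * ρ ^ 2) with hc₂
  set c₃ := 2 * m * N * κ / ρ with hc₃
  set α := alphaExp m p q with hα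
  have hα0 : 0 < α := alphaExp_pos hpq hmpq
  have hc₂' := sigmaConst_identity (k := k) (p := p) (d := d) (by linarith : 0 < m) hρ
  have hm₁' : m₁ = 2 * k * N * m / ρ + 2 * a * V + c₂ * α * ε ^ ((α - 1) / α) := by
    rw [hc₂, ← hc₂', hm₁, M₁]; ring
  have hm₂' : m₂ = 2 * b - c₂ * ε * (1 - α) := by
    rw [hc₂, ← hc₂', hm₂, M₂]; ring
  have hc₂0 : 0 ≤ c₂ := by positivity
  have hc₃0 : 0 ≤ c₃ := by positivity
  have hlap := integral_mul_laplacian_le hφ hΩ hbd hδ hv hpos hk (by linarith) (by linarith) hρ hκ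
    hd hstar hflux
  have hcont1 : ContinuousOn (fun x => 2 * k * N * m / ρ * u x t ^ (p + 1)
      + c₂ * u x t ^ (2 * p - m + 1) + c₃) Ω :=
    ((continuousOn_const.mul (hvr _)).add (continuousOn_const.mul (hvr _))).add continuousOn_const
  have hcont2 : ContinuousOn (fun x => 2 * a * I * u x t - 2 * b * u x t ^ (q + 1)) Ω :=
    (continuousOn_const.mul hvc).sub (continuousOn_const.mul (hvr _))
  have hderiv := (hu.hasDerivAt_integral hΩ hη1.continuous hηΩ hηc ht).1
  have hi1 := integrable_mul_of_tsupport_subset hΩ hη1.continuous hηΩ hηc hcont1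
  have hi2 := integrable_mul_of_tsupport_subset hΩ hη1.continuous hηΩ hηc hcont2
  have hw : ContDiffOn ℝ 2 (fun y => u y t ^ m) Ω := fun x hx =>
    (hv x hx).rpow_const_of_ne (hpos x hx).ne'
  have hlapc : ContinuousOn (Laplacian.laplacian fun y => u y t ^ m) Ω :=
    continuousOn_laplacian hΩ hw
  have hi3 : Integrable fun x =>
      η x * (2 * u x t * Laplacian.laplacian (fun y => u y t ^ m) x) :=
    integrable_mul_of_tsupport_subset hΩ hη1.continuous hηΩ hηc
    ((continuousOn_const (c := (2 : ℝ)).mul hvc).mul hlapc)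
  have hstep1 : ∫ x, η x * (2 * u x t * deriv (u x) t) ≤
      (∫ x, η x * (2 * u x t * Laplacian.laplacian (fun y => u y t ^ m) x))
        + ∫ x, η x * (2 * a * I * u x t - 2 * b * u x t ^ (q + 1)) := by
    rw [← integral_add hi3 hi2]
    refine integral_mono hderiv (hi3.add hi2) fun x => ?_
    by_cases hx : x ∈ Ω
    · have hux := hpos x hx
      have e1 : u x t ^ (q + 1) = u x t ^ q * u x t := by
        rw [Real.rpow_add hux, Real.rpow_one]
      have e2 : deriv (u x) t ≤ Laplacian.laplacian (fun y => u y t ^ m) x + a * I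
          - b * u x t ^ q := by
        have := hu.equation x hx t ht
        have : 0 ≤ c * ‖gradient (fun y => √(u y t)) x‖ ^ 2 := by positivity
        linarith
      have e3 := mul_le_mul_of_nonneg_left e2
        (show 0 ≤ η x * (2 * u x t) from mul_nonneg cutoff_nonneg (by linarith))
      beta_reduce
      rw [e1]
      linarith
    · have : η x = 0 := image_eq_zero_of_notMem_tsupport fun h => hx (hηΩ h)
      simp [this]
  have hstep2 : ∫ x, η x * (2 * u x t * deriv (u x) t) ≤
      ∫ x in Ω, (η x * (2 * k * N * m / ρ * u x t ^ (p + 1) + c₂ * u x t ^ (2 * p - m + 1) + c₃)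
        + η x * (2 * a * I * u x t - 2 * b * u x t ^ (q + 1))) := by
    rw [integral_add hi1.integrableOn hi2.integrableOn, setIntegral_mul_of_tsupport_subset hηΩ,
      setIntegral_mul_of_tsupport_subset hηΩ]
    linarith
  have j0 : IntegrableOn (fun x => u x t) Ω := by
    simpa using hu.integrableOn_rpow hbd ht' zero_le_one
  have j1 : IntegrableOn (fun x => u x t ^ (p + 1)) Ω :=
    hu.integrableOn_rpow hbd ht' (by linarith)
  have j2 : IntegrableOn (fun x => u x t ^ (q + 1)) Ω :=
    hu.integrableOn_rpow hbd ht' (by linarith)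
  have jfin : IsFiniteMeasure (volume.restrict Ω) := ⟨by
    rw [Measure.restrict_apply_univ]; exact hbd.measure_lt_top⟩
  have j3 : IntegrableOn (fun x => 1 - η x) Ω :=
    (integrable_const (1 : ℝ)).sub
      (hη1.continuous.integrable_of_hasCompactSupport hηc).integrableOn
  have hcheb : (∫ x in Ω, u x t) * I ≤ V * ∫ x in Ω, u x t ^ (p + 1) := by
    have h := integral_mul_integral_rpow_le (μ := volume.restrict Ω) (f := fun x => u x t) (p := p)
      (by linarith) ((ae_restrict_iff' hΩ.measurableSet).2
        (Filter.Eventually.of_forall fun x hx => (hpos x hx).le)) j0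
      (hu.integrableOn_rpow hbd ht' (by linarith)) j1
    rwa [measureReal_restrict_apply_univ] at h
  have hstep3 : ∫ x in Ω, (η x * (2 * k * N * m / ρ * u x t ^ (p + 1)
        + c₂ * u x t ^ (2 * p - m + 1) + c₃)
        + η x * (2 * a * I * u x t - 2 * b * u x t ^ (q + 1))) ≤
      ∫ x in Ω, ((m₁ * u x t ^ (p + 1) - m₂ * u x t ^ (q + 1))
        + 2 * a * (I * u x t - V * u x t ^ (p + 1)) + c₃ + m₂ * B ^ (q + 1) * (1 - η x)) := by
    refine setIntegral_mono_on (hi1.integrableOn.add hi2.integrableOn)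
      (((((j1.const_mul m₁).sub (j2.const_mul m₂)).add
        (((j0.const_mul I).sub (j1.const_mul V)).const_mul (2 * a))).add
          (integrable_const c₃)).add (j3.const_mul (m₂ * B ^ (q + 1)))) hΩ.measurableSet
      fun x hx => ?_
    have hux := hpos x hx
    have hy := rpow_le_young (ε := ε) hmp hpq hmpq hε hux
    rw [← hα] at hy
    have hη0 : 0 ≤ η x := cutoff_nonneg
    have hη1' : η x ≤ 1 := cutoff_le_one
    have hBq : u x t ^ (q + 1) ≤ B ^ (q + 1) :=
      Real.rpow_le_rpow hux.le (hB x hx) (by linarith)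
    have e1 := mul_le_mul_of_nonneg_left (mul_le_mul_of_nonneg_left hy hc₂0) hη0
    -- the favourable part of the cut-off integrand, without the absorption term
    set P := 2 * a * I * u x t + (m₁ - 2 * a * V) * u x t ^ (p + 1) + c₃ with hP
    have hP0 : 0 ≤ P := by
      have : 0 ≤ m₁ - 2 * a * V := by
        have : 0 ≤ c₂ * α * ε ^ ((α - 1) / α) := by positivity
        have : 0 ≤ 2 * k * N * m / ρ := by positivity
        linarith
      positivity
    have e2 : η x * P ≤ P := mul_le_of_le_one_left hP0 hη1'
    have e3 : (1 - η x) * (m₂ * u x t ^ (q + 1)) ≤ (1 - η x) * (m₂ * B ^ (q + 1)) := by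
      gcongr
    have e4 : η x * P - η x * (m₂ * u x t ^ (q + 1)) =
        η x * (c₂ * (α * (ε ^ ((α - 1) / α) * u x t ^ (p + 1))
          + (1 - α) * (ε * u x t ^ (q + 1))))
        + η x * (2 * k * N * m / ρ * u x t ^ (p + 1) + c₃)
        + η x * (2 * a * I * u x t - 2 * b * u x t ^ (q + 1)) := by
      rw [hP, hm₁', hm₂']; ring
    have e5 : P = m₁ * u x t ^ (p + 1) + 2 * a * (I * u x t - V * u x t ^ (p + 1)) + c₃ := by
      rw [hP]; ring
    linarith
  refine hstep2.trans (hstep3.trans ?_)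
  have k1 : IntegrableOn (fun x => m₁ * u x t ^ (p + 1) - m₂ * u x t ^ (q + 1)) Ω :=
    (j1.const_mul m₁).sub (j2.const_mul m₂)
  have k2 : IntegrableOn (fun x => 2 * a * (I * u x t - V * u x t ^ (p + 1))) Ω :=
    ((j0.const_mul I).sub (j1.const_mul V)).const_mul (2 * a)
  have k12 : IntegrableOn (fun x => m₁ * u x t ^ (p + 1) - m₂ * u x t ^ (q + 1)
      + 2 * a * (I * u x t - V * u x t ^ (p + 1))) Ω := k1.add k2
  have k123 : IntegrableOn (fun x => m₁ * u x t ^ (p + 1) - m₂ * u x t ^ (q + 1)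
      + 2 * a * (I * u x t - V * u x t ^ (p + 1)) + c₃) Ω := k12.add (integrable_const c₃)
  rw [integral_add k123 (j3.const_mul _), integral_add k12 (integrable_const c₃),
    integral_add k1 k2, integral_const_mul, integral_const_mul,
    integral_sub (j0.const_mul I) (j1.const_mul V), integral_const_mul, integral_const_mul,
    integral_const, measureReal_restrict_apply_univ, smul_eq_mul]
  have := mul_le_mul_of_nonneg_left hcheb (show 0 ≤ 2 * a by positivity)
  linarith

end Energy

/-! ### The bound of the square integral -/

/-- The last time at which a continuous function takes an intermediate value `K`. -/
theorem exists_last_time_eq {y : ℝ → ℝ} {t₁ K : ℝ} (ht₁ : 0 ≤ t₁) (hy : ContinuousOn y (Icc 0 t₁))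
    (h0 : y 0 < K) (h1 : K < y t₁) :
    ∃ s, 0 < s ∧ s < t₁ ∧ y s = K ∧ ∀ t ∈ Icc s t₁, K ≤ y t := by
  set S := Icc 0 t₁ ∩ y ⁻¹' Iic K with hS
  have hSc : IsCompact S := isCompact_Icc.of_isClosed_subset
    (hy.preimage_isClosed_of_isClosed isClosed_Icc isClosed_Iic) inter_subset_left
  obtain ⟨s, ⟨hs, hsK⟩, hmax⟩ := hSc.exists_isMaxOn ⟨0, ⟨le_rfl, ht₁⟩, h0.le⟩ continuousOn_id
  have hsK : y s ≤ K := hsK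
  have heq : y s = K := by
    obtain ⟨r, hr, hrK⟩ := intermediate_value_Icc hs.2 (hy.mono (Icc_subset_Icc_left hs.1))
      ⟨hsK, h1.le⟩
    have : r ≤ s := hmax (show r ∈ S from ⟨⟨hs.1.trans hr.1, hr.2⟩, hrK.le⟩)
    rw [← hrK, le_antisymm this hr.1]
  refine ⟨s, hs.1.lt_of_ne fun h => ?_, hs.2.lt_of_ne fun h => ?_, heq, fun t ht => ?_⟩
  · rw [h] at h0; linarith
  · rw [h] at heq; linarith
  · by_contra! hlt
    have : t ≤ s := hmax (show t ∈ S from ⟨⟨hs.1.trans ht.1, ht.2⟩, hlt.le⟩)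
    rw [le_antisymm this ht.1] at hlt
    linarith

theorem IsDefiningFunction.tendsto_integral_cutoff_mul {N : ℕ}
    {Ω : Set (EuclideanSpace ℝ (Fin N))} {φ f : EuclideanSpace ℝ (Fin N) → ℝ}
    (hφ : IsDefiningFunction φ Ω) (hΩ : IsOpen Ω) (hf : IntegrableOn f Ω) {δ : ℕ → ℝ}
    (hδ : ∀ n, 0 < δ n) (hδ0 : Filter.Tendsto δ Filter.atTop (𝓝 0)) :
    Filter.Tendsto (fun n => ∫ x in Ω, cutoff φ (δ n) x * f x) Filter.atTop
      (𝓝 (∫ x in Ω, f x)) := by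
  have hη : ∀ n, Continuous (cutoff φ (δ n)) := fun n =>
    (contDiff_cutoff (hφ.smooth.of_le (by norm_cast))).continuous
  refine tendsto_integral_of_dominated_convergence (fun x => ‖f x‖)
    (fun n => (hη n).aestronglyMeasurable.mul hf.aestronglyMeasurable) hf.norm ?_ ?_
  · refine fun n => Filter.Eventually.of_forall fun x => ?_
    rw [norm_mul, Real.norm_of_nonneg cutoff_nonneg]
    exact mul_le_of_le_one_left (norm_nonneg _) cutoff_le_one
  · refine (ae_restrict_iff' hΩ.measurableSet).2 (Filter.Eventually.of_forall fun x hx => ?_)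
    refine tendsto_const_nhds.congr' ?_
    have hlt : 0 < -φ x / 2 := by linarith [hφ.mem_iff.1 hx]
    filter_upwards [hδ0.eventually_lt_const hlt] with n hn
    rw [cutoff_eq_one (hδ n) (by linarith), one_mul]

theorem M₁_pos {N : ℕ} {V a k m p q ρ d ε : ℝ} (ha : 0 < a) (hk : 0 ≤ k) (hm : 0 < m)
    (hpq : p < q) (hmpq : 2 * p < m + q) (hρ : 0 < ρ) (hV : 0 < V) (hε : 0 < ε) :
    0 < M₁ N V a k m p q ρ d ε := by
  have hα := alphaExp_pos hpq hmpq
  have h1 : 0 < 2 * a * V := by positivity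
  have h2 : 0 ≤ 2 * k * N * m / ρ := by positivity
  have h3 : 0 ≤ 8 * m * sigmaConst k m p ρ d ^ 2 * alphaExp m p q / (m + 1) ^ 2
      * ε ^ ((alphaExp m p q - 1) / alphaExp m p q) := by positivity
  rw [M₁]; linarith

theorem continuousAt_M₁ {N : ℕ} {V a k m p q ρ d ε : ℝ} (hρ : ρ ≠ 0) :
    ContinuousAt (fun ρ => M₁ N V a k m p q ρ d ε) ρ := by
  unfold M₁ sigmaConst
  fun_prop (disch := simpa)

theorem continuousAt_M₂ {b k m p q ρ d ε : ℝ} (hρ : ρ ≠ 0) :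
    ContinuousAt (fun ρ => M₂ b k m p q ρ d ε) ρ := by
  unfold M₂ sigmaConst
  fun_prop (disch := simpa)

section Energy

variable {N : ℕ} {Ω : Set (EuclideanSpace ℝ (Fin N))} {a b c k m p q : ℝ} {g : ℝ → ℝ}
  {u₀ : EuclideanSpace ℝ (Fin N) → ℝ} {T : EReal} {u : EuclideanSpace ℝ (Fin N) → ℝ → ℝ}
  {x₀ : EuclideanSpace ℝ (Fin N)} {ρ₀ d : ℝ}

theorem AssumptionA.norm_sub_le (hΩ : AssumptionA Ω x₀ ρ₀ d) {x : EuclideanSpace ℝ (Fin N)}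
    (hx : x ∈ closure Ω) : ‖x - x₀‖ ≤ d :=
  hΩ.isGreatest_d.2 ⟨x, hx, rfl⟩

theorem AssumptionA.volume_pos (hΩ : AssumptionA Ω x₀ ρ₀ d) : 0 < volume.real Ω :=
  ENNReal.toReal_pos (hΩ.domain.isOpen.measure_pos volume ⟨x₀, hΩ.center_mem⟩).ne'
    hΩ.domain.isBounded.measure_lt_top.ne

/-- Strict star-shapedness, with any constant below `ρ₀`, holds in a boundary layer. -/
theorem AssumptionA.exists_star_layer (hΩ : AssumptionA Ω x₀ ρ₀ d)
    {φ : EuclideanSpace ℝ (Fin N) → ℝ} (hφ : IsDefiningFunction φ Ω) {ρ : ℝ} (hρ : ρ < ρ₀) :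
    ∃ δ > 0, ∀ x ∈ Ω, -δ ≤ φ x → ρ * ‖gradient φ x‖ ≤ inner ℝ (x - x₀) (gradient φ x) := by
  have hgc := continuous_gradient (hφ.smooth.of_le (by norm_cast) : ContDiff ℝ 1 φ)
  obtain ⟨δ, hδ, h⟩ := hφ.exists_layer hΩ.domain.isBounded (s := 0) (t := 0)
    (F := fun z => inner ℝ (z.1 - x₀) (gradient φ z.1) - ρ * ‖gradient φ z.1‖)
    (by fun_prop) (fun x hx τ _ => by
      have hn := norm_pos_iff.2 (hφ.gradient_ne_zero x hx)
      have h1 : ρ₀ ≤ inner ℝ (x - x₀) (‖gradient φ x‖⁻¹ • gradient φ x) :=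
        hΩ.isLeast_rho.2 ⟨x, _, hφ.isOutwardUnitNormal hx, rfl⟩
      rw [inner_smul_right, ← div_eq_inv_mul, le_div_iff₀ hn] at h1
      have := mul_lt_mul_of_pos_right hρ hn
      linarith)
  exact ⟨δ, hδ, fun x hx hlt => by linarith [h x hx hlt 0 ⟨le_rfl, le_rfl⟩]⟩

/-- The flux condition, multiplied by `u ^ m` and relaxed by `κ`, holds in a boundary layer. The
factor `u ^ m` makes an additive slack sufficient even where `u` vanishes on the boundary. -/
theorem IsClassicalSolution.exists_flux_layer
    (hu : IsClassicalSolution Ω a b c m p q g u₀ T u) (hbd : Bornology.IsBounded Ω)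
    {φ : EuclideanSpace ℝ (Fin N) → ℝ} (hφ : IsDefiningFunction φ Ω)
    (hm : 1 < m) (hmp : m < p)
    (hg : ∀ ξ : ℝ, 0 ≤ ξ → g ξ ≤ k * ξ ^ (p - m + 1)) {κ s t : ℝ} (hκ : 0 < κ)
    (hst : Icc s t ⊆ timeIco T) :
    ∃ δ > 0, ∀ x ∈ Ω, -δ ≤ φ x → ∀ τ ∈ Icc s t,
      u x τ ^ m * inner ℝ (gradient (fun y => u y τ) x) (gradient φ x) ≤
        (k * u x τ ^ (p + 1) + κ) * ‖gradient φ x‖ := by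
  obtain ⟨G, hG, hGn⟩ := hu.regular_boundary
  have hgc := continuous_gradient (hφ.smooth.of_le (by norm_cast) : ContDiff ℝ 1 φ)
  have hsub : closure Ω ×ˢ Icc s t ⊆ closure Ω ×ˢ timeIco T := prod_mono subset_rfl hst
  have hcu := hG.continuousOn.mono hsub
  have hcG := hG.continuousOn_grad.mono hsub
  have hcg : ContinuousOn (fun z : EuclideanSpace ℝ (Fin N) × ℝ => gradient φ z.1)
      (closure Ω ×ˢ Icc s t) := (hgc.comp continuous_fst).continuousOn
  obtain ⟨δ, hδ, h⟩ := hφ.exists_layer hbd (s := s) (t := t)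
    (F := fun z => (k * u z.1 z.2 ^ (p + 1) + κ) * ‖gradient φ z.1‖
      - u z.1 z.2 ^ m * inner ℝ (G z.1 z.2) (gradient φ z.1))
    ((((continuousOn_const.mul (hcu.rpow_const fun _ _ => Or.inr (by linarith))).add
      continuousOn_const).mul hcg.norm).sub
      ((hcu.rpow_const fun _ _ => Or.inr (by linarith)).mul (hcG.inner hcg)))
    (fun x hx τ hτ => by
      have hn := norm_pos_iff.2 (hφ.gradient_ne_zero x hx)
      have h2 : inner ℝ (G x τ) (gradient φ x) = ‖gradient φ x‖ * g (u x τ) := by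
        have := hGn τ (hst hτ) x _ (hφ.isOutwardUnitNormal hx)
        rw [inner_smul_right] at this
        rw [← this]; field_simp
      have hux := hu.nonneg (frontier_subset_closure hx) (hst hτ)
      have h3 : u x τ ^ m * g (u x τ) ≤ k * u x τ ^ (p + 1) := by
        calc u x τ ^ m * g (u x τ) ≤ u x τ ^ m * (k * u x τ ^ (p - m + 1)) := by
              gcongr; exact hg _ hux
          _ = k * u x τ ^ (p + 1) := by
              have : u x τ ^ (p + 1) = u x τ ^ m * u x τ ^ (p - m + 1) := by
                rw [← Real.rpow_add_of_nonneg hux (by linarith) (by linarith)]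
                congr 1; ring
              rw [this]; ring
      have h4 := mul_le_mul_of_nonneg_right h3 hn.le
      have h5 := mul_pos hκ hn
      rw [h2]
      linarith)
  refine ⟨δ, hδ, fun x hx hlt τ hτ => ?_⟩
  rw [(hG.hasGradientAt x hx τ (hst hτ)).gradient]
  linarith [h x hx hlt τ hτ]

theorem IsClassicalSolution.continuousOn_integral_sq
    (hu : IsClassicalSolution Ω a b c m p q g u₀ T u) (hΩ : IsOpen Ω)
    (hbd : Bornology.IsBounded Ω) {B : ℝ} (hB : ∀ t ∈ timeIco T, ∀ x ∈ closure Ω, u x t ≤ B) :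
    ContinuousOn (fun t => ∫ x in Ω, u x t ^ 2) (timeIco T) := by
  obtain ⟨G, hG, -⟩ := hu.regular_boundary
  refine continuousOn_of_dominated (bound := fun _ => B ^ 2) (fun t ht => ?_) (fun t ht => ?_)
    (integrableOn_const hbd.measure_lt_top.ne) ?_
  · exact (((hu.continuousOn_closure ht).mono subset_closure).pow 2).aestronglyMeasurable
      hΩ.measurableSet
  · refine (ae_restrict_iff' hΩ.measurableSet).2 (Filter.Eventually.of_forall fun x hx => ?_)
    rw [Real.norm_of_nonneg (sq_nonneg _)]
    exact pow_le_pow_left₀ (hu.pos x hx t ht).le (hB t ht x (subset_closure hx)) 2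
  · refine (ae_restrict_iff' hΩ.measurableSet).2 (Filter.Eventually.of_forall fun x hx => ?_)
    exact (hG.continuousOn.comp (f := fun t => (x, t)) (by fun_prop)
      fun t ht => ⟨subset_closure hx, ht⟩).pow 2

/-- The bound with a radius `ρ` strictly smaller than `ρ₀`. -/
theorem IsClassicalSolution.integral_sq_le_of_lt
    (hu : IsClassicalSolution Ω a b c m p q g u₀ T u) (hΩ : AssumptionA Ω x₀ ρ₀ d)
    (ha : 0 < a) (hb : 0 < b) (hc : 0 ≤ c) (hk : 0 ≤ k) (hm : 1 < m) (hmp : m < p) (hpq : p < q)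
    (hmpq : 2 * p < m + q) (hg : ∀ ξ : ℝ, 0 ≤ ξ → g ξ ≤ k * ξ ^ (p - m + 1)) {ρ ε : ℝ}
    (hρ : 0 < ρ) (hρ₀ : ρ < ρ₀) (hε : 0 < ε) (hM₂ : 0 < M₂ b k m p q ρ d ε) {t : ℝ}
    (ht : t ∈ timeIco T) :
    ∫ x in Ω, u x t ^ 2 ≤ max (∫ x in Ω, u x 0 ^ 2) (volume.real Ω *
      (M₁ N (volume.real Ω) a k m p q ρ d ε / M₂ b k m p q ρ d ε) ^ (2 / (q - p))) := by
  have hop := hΩ.domain.isOpen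
  have hbd := hΩ.domain.isBounded
  obtain ⟨φ, hφ⟩ := hΩ.domain.smooth_boundary
  obtain ⟨B, hB⟩ := hu.exists_bound hΩ.domain ha.le hb hc hk hm hmp hpq hmpq hg
  have hV := hΩ.volume_pos
  have hM₁ := M₁_pos (N := N) (d := d) ha hk (by linarith : 0 < m) hpq hmpq hρ hV hε
  obtain ⟨C, hC, hlin⟩ := exists_linear_bound (by linarith : 1 ≤ p) hpq hM₁ hM₂
  set V := volume.real Ω with hVdef
  set m₁ := M₁ N V a k m p q ρ d ε with hm₁
  set m₂ := M₂ b k m p q ρ d ε with hm₂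
  set Λ := (m₁ / m₂) ^ (2 / (q - p)) with hΛ
  set y : ℝ → ℝ := fun t => ∫ x in Ω, u x t ^ 2 with hy
  by_contra! hcon
  set K' := max (y 0) (V * Λ) with hK'
  have hcon : K' < y t := hcon
  -- `K` lies strictly above the bound, which keeps the crossing time away from `0` and leaves a
  -- margin for the errors
  set K := (K' + y t) / 2 with hK
  have hKK' : K' < K := by rw [hK]; linarith
  have hKt : K < y t := by rw [hK]; linarith
  have hyc : ContinuousOn y (timeIco T) := hu.continuousOn_integral_sq hop hbd hB
  obtain ⟨s, hs0, hst, hsK, hge⟩ := exists_last_time_eq ht.1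
    (hyc.mono fun r hr => mem_timeIco_of_le ht hr.1 hr.2)
    ((le_max_left _ _).trans_lt hKK') hKt
  have hIcc : Icc s t ⊆ timeIoo T := fun r hr =>
    ⟨hs0.trans_le hr.1, (mem_timeIco_of_le ht (hs0.le.trans hr.1) hr.2).2⟩
  have hIcc' : Icc s t ⊆ timeIco T := fun r hr => mem_timeIco_of_mem_timeIoo (hIcc hr)
  -- on `[s, t]` the leading terms are at most `-h`, which absorbs the two errors
  set h := C * (K - V * Λ) with hh
  have hh0 : 0 < h := mul_pos hC (by linarith [le_max_right (y 0) (V * Λ)])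
  have hlead : ∀ r ∈ Icc s t,
      ∫ x in Ω, (m₁ * u x r ^ (p + 1) - m₂ * u x r ^ (q + 1)) ≤ -h := by
    intro r hr
    have hr' := hIcc' hr
    have i0 : IntegrableOn (fun x => u x r ^ 2) Ω := by
      simpa using hu.integrableOn_rpow hbd hr' (r := 2) (by norm_num)
    have i1 : IntegrableOn (fun _ : EuclideanSpace ℝ (Fin N) => Λ) Ω :=
      integrableOn_const hbd.measure_lt_top.ne
    have h1 : ∫ x in Ω, (m₁ * u x r ^ (p + 1) - m₂ * u x r ^ (q + 1)) ≤
        ∫ x in Ω, C * (Λ - u x r ^ 2) :=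
      setIntegral_mono_on
        (((hu.integrableOn_rpow hbd hr' (by linarith)).const_mul m₁).sub
          ((hu.integrableOn_rpow hbd hr' (by linarith)).const_mul m₂))
        ((i1.sub i0).const_mul C) hop.measurableSet fun x hx => hlin _ (hu.pos x hx r hr')
    rw [integral_const_mul, integral_sub i1 i0, setIntegral_const, smul_eq_mul] at h1
    have h2 : K ≤ y r := hge r hr
    have h3 := mul_le_mul_of_nonneg_left h2 hC.le
    change _ ≤ C * (V * Λ - y r) at h1
    rw [hh]
    linarith
  -- with this slack the `κ`-error is at most `h / 2`
  set κ := h * ρ / (2 * (2 * m * N * V + 1)) with hκ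
  have hmN : 0 ≤ 2 * m * N * V := by positivity
  have hκ0 : 0 < κ := by positivity
  have herr1 : 2 * m * N * κ / ρ * V ≤ h / 2 := by
    have : 2 * m * N * κ / ρ * V = (2 * m * N * V) / (2 * m * N * V + 1) * (h / 2) := by
      rw [hκ]; field_simp
    rw [this]
    refine mul_le_of_le_one_left (by linarith) ?_
    rw [div_le_one (by linarith)]; linarith
  obtain ⟨δ₁, hδ₁, hstar⟩ := hΩ.exists_star_layer hφ hρ₀
  obtain ⟨δ₂, hδ₂, hflux⟩ := hu.exists_flux_layer hbd hφ hm hmp hg hκ0 hIcc'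
  set δ : ℕ → ℝ := fun n => 1 / ((n : ℝ) + 1) with hδ
  have hδ0 : ∀ n, 0 < δ n := fun n => by positivity
  have hδt : Filter.Tendsto δ Filter.atTop (𝓝 0) := tendsto_one_div_add_atTop_nhds_zero_nat
  have hlim1 : Filter.Tendsto (fun n => m₂ * B ^ (q + 1) * ∫ x in Ω, (1 - cutoff φ (δ n) x))
      Filter.atTop (𝓝 0) := by
    have i1 : IntegrableOn (fun _ : EuclideanSpace ℝ (Fin N) => (1 : ℝ)) Ω :=
      integrableOn_const hbd.measure_lt_top.ne
    have h1 := (hφ.tendsto_integral_cutoff_mul hop i1 hδ0 hδt).const_sub (∫ x in Ω, (1 : ℝ))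
    rw [sub_self] at h1
    have h2 := h1.const_mul (m₂ * B ^ (q + 1))
    rw [mul_zero] at h2
    refine h2.congr fun n => ?_
    have i2 : Integrable (cutoff φ (δ n)) :=
      (contDiff_cutoff (hφ.smooth.of_le (by norm_cast))).continuous.integrable_of_hasCompactSupport
        (hφ.hasCompactSupport_cutoff hbd (hδ0 n))
    rw [integral_sub i1 i2.integrableOn]
    simp only [mul_one]
  have hlim2 : ∀ r ∈ Icc s t, Filter.Tendsto (fun n => ∫ x, cutoff φ (δ n) x * u x r ^ 2)
      Filter.atTop (𝓝 (y r)) := by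
    intro r hr
    have i0 : IntegrableOn (fun x => u x r ^ 2) Ω := by
      simpa using hu.integrableOn_rpow hbd (hIcc' hr) (r := 2) (by norm_num)
    refine (hφ.tendsto_integral_cutoff_mul hop i0 hδ0 hδt).congr fun n => ?_
    exact setIntegral_mul_of_tsupport_subset (hφ.tsupport_cutoff_subset (hδ0 n))
  have hst' : y t ≤ y s := by
    refine le_of_tendsto_of_tendsto (hlim2 t ⟨hst.le, le_rfl⟩) (hlim2 s ⟨le_rfl, hst.le⟩) ?_
    filter_upwards [hlim1.eventually_lt_const (half_pos hh0),
      hδt.eventually_lt_const (half_pos hδ₁), hδt.eventually_lt_const (half_pos hδ₂)]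
      with n hn1 hn2 hn3
    have hder : ∀ r ∈ Icc s t, HasDerivAt (fun r => ∫ x, cutoff φ (δ n) x * u x r ^ 2)
        (∫ x, cutoff φ (δ n) x * (2 * u x r * deriv (u x) r)) r := fun r hr =>
      (hu.hasDerivAt_integral hop
        (contDiff_cutoff (hφ.smooth.of_le (by norm_cast))).continuous
        (hφ.tsupport_cutoff_subset (hδ0 n)) (hφ.hasCompactSupport_cutoff hbd (hδ0 n))
        (hIcc hr)).2
    refine antitoneOn_of_deriv_nonpos (convex_Icc s t)
      (fun r hr => (hder r hr).continuousAt.continuousWithinAt)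
      (fun r hr => (hder r (interior_subset hr)).differentiableAt.differentiableWithinAt)
      (fun r hr => ?_) ⟨le_rfl, hst.le⟩ ⟨hst.le, le_rfl⟩ hst.le
    have hr := interior_subset hr
    rw [(hder r hr).deriv]
    have h1 := hu.integral_cutoff_le hop hbd hφ ha.le hc hk hm hmp hpq hmpq (hδ0 n) hρ hκ0.le hε
      hM₂ (hIcc hr) (fun x hx => hB r (hIcc' hr) x (subset_closure hx))
      (fun x hx => hΩ.norm_sub_le (subset_closure hx))
      (fun x hx hlt => hstar x hx (by linarith)) (fun x hx hlt => hflux x hx (by linarith) r hr)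
    have h2 := hlead r hr
    linarith
  linarith

/-- **Bound of the `L ^ 2` norm.** -/
theorem IsClassicalSolution.integral_sq_le
    (hu : IsClassicalSolution Ω a b c m p q g u₀ T u) (hΩ : AssumptionA Ω x₀ ρ₀ d)
    (ha : 0 < a) (hb : 0 < b) (hc : 0 ≤ c) (hk : 0 ≤ k) (hm : 1 < m) (hmp : m < p) (hpq : p < q)
    (hmpq : 2 * p < m + q) (hg : ∀ ξ : ℝ, 0 ≤ ξ → g ξ ≤ k * ξ ^ (p - m + 1)) {ε : ℝ}
    (hε : 0 < ε) (hM₂ : 0 < M₂ b k m p q ρ₀ d ε) {t : ℝ} (ht : t ∈ timeIco T) :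
    ∫ x in Ω, u x t ^ 2 ≤ max (∫ x in Ω, u x 0 ^ 2) (volume.real Ω *
      (M₁ N (volume.real Ω) a k m p q ρ₀ d ε / M₂ b k m p q ρ₀ d ε) ^ (2 / (q - p))) := by
  have hρ₀ := hΩ.rho_pos
  have hc₂ := continuousAt_M₂ (b := b) (k := k) (m := m) (p := p) (q := q) (d := d) (ε := ε)
    hρ₀.ne'
  have hc₁ := continuousAt_M₁ (N := N) (V := volume.real Ω) (a := a) (k := k) (m := m) (p := p)
    (q := q) (d := d) (ε := ε) hρ₀.ne'
  have hlim := ((hc₁.div hc₂ hM₂.ne').rpow_const (p := 2 / (q - p))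
    (Or.inr (div_nonneg zero_le_two (sub_pos.2 hpq).le))).const_mul (volume.real Ω)
  have hlim' := (Filter.Tendsto.max (tendsto_const_nhds (x := ∫ x in Ω, u x 0 ^ 2))
    hlim.tendsto).mono_left (nhdsWithin_le_nhds (s := Iio ρ₀))
  refine ge_of_tendsto hlim' ?_
  filter_upwards [Ioo_mem_nhdsLT hρ₀, nhdsWithin_le_nhds (hc₂.eventually_const_lt hM₂)]
    with ρ hρ hM
  exact hu.integral_sq_le_of_lt hΩ ha hb hc hk hm hmp hpq hmpq hg hρ.1 hρ.2 hε hM ht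

end Energy

theorem theorem3 (N : ℕ) (hN : 1 ≤ N) (Ω : Set (EuclideanSpace ℝ (Fin N)))
    (x₀ : EuclideanSpace ℝ (Fin N)) (ρ₀ d : ℝ) (hΩ : AssumptionA Ω x₀ ρ₀ d)
    (a b c k m p q : ℝ) (ha : 0 < a) (hb : 0 < b) (hc : 0 < c) (hk : 0 < k)
    (hm : 1 < m) (hmp : m < p) (hpq : p < q) (hmpq : 2 * p < m + q)
    (g : ℝ → ℝ) (hg : ∀ ξ : ℝ, 0 ≤ ξ → 0 ≤ g ξ ∧ g ξ ≤ k * ξ ^ (p - m + 1))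
    (u₀ : EuclideanSpace ℝ (Fin N) → ℝ) (hu₀_pos : ∀ x ∈ Ω, 0 < u₀ x)
    (θ : ℝ≥0) (hθ₀ : 0 < θ) (hθ₁ : θ < 1) (hu₀_holder : IsC2Holder Ω θ u₀)
    (G₀ : EuclideanSpace ℝ (Fin N) → EuclideanSpace ℝ (Fin N))
    (hu₀_C1 : IsC1UpToBoundary Ω u₀ G₀)
    (hu₀_compat : ∀ x n, IsOutwardUnitNormal Ω x n → inner ℝ (G₀ x) n = g (u₀ x))
    (tstar : EReal) (u : EuclideanSpace ℝ (Fin N) → ℝ → ℝ)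
    (hu : IsClassicalSolution Ω a b c m p q g u₀ tstar u) :
    (∀ ε : ℝ, 0 < ε → 0 < M₂ b k m p q ρ₀ d ε → ∀ t ∈ timeIco tstar,
      ∫ x in Ω, u x t ^ 2 ≤
        max (∫ x in Ω, u₀ x ^ 2)
          (volume.real Ω *
            (M₁ N (volume.real Ω) a k m p q ρ₀ d ε / M₂ b k m p q ρ₀ d ε) ^ (2 / (q - p))))
    ∧ (IsMaximalTime Ω tstar u → tstar = ⊤) := by
  have hg' : ∀ ξ : ℝ, 0 ≤ ξ → g ξ ≤ k * ξ ^ (p - m + 1) := fun ξ hξ => (hg ξ hξ).2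
  refine ⟨fun ε hε hM₂ t ht => ?_, fun hT => ?_⟩
  · have h := hu.integral_sq_le hΩ ha hb hc.le hk.le hm hmp hpq hmpq hg' hε hM₂ ht
    rwa [setIntegral_congr_fun hΩ.domain.isOpen.measurableSet
      fun x hx => congrArg (· ^ 2) (hu.initial x hx)] at h
  · exact hu.eq_top_of_isMaximalTime hΩ.domain ha.le hb hc.le hk.le hm hmp hpq hmpq hg' hT
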